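/- **Setting.** Let $m,n\ge 1$ be natural numbers, $p\in(1,\infty)$, let $D\subseteq\mathbb R^n$ be a bounded open set and $\mathcal G$ a subgroup of $SO(n)$. For $\varepsilon>0$ let $\Gamma_\varepsilon=\{x\mapsto \varepsilon Rx+h : R\in\mathcal G,\ h\in\mathbb R^n\}$ and $\Gamma=\bigcup_{\varepsilon>0}\Gamma_\varepsilon$. For $\Omega\subseteq\mathbb R^n$ let $\mathcal G^D_\varepsilon(\Omega)=\{F(D): F\in\Gamma_\varepsilon,\ F(D)\subseteq\Omega\}$ and $\mathcal G^D(\Omega)=\bigcup_{\varepsilon>0}\mathcal G^D_\varepsilon(\Omega)$. Norms $|\cdot|_2$ are Euclidean on vectors and the induced operator norm on matrices. For a linear map $\mathfrak L:\mathbb R^{m\times n}\to\mathbb R^{m\times n}$, an open set $U\subseteq\mathbb R^n$ and $v\in L^1_{\rm loc}(U;\mathbb R^m)$, the matrix of distributions $D_{\mathfrak L}v$ on $U$ is defined by $\langle D_{\mathfrak L}v,\varphi\rangle=-\int_U\mathfrak L(v\otimes\nabla\varphi)\,dx$ for $\varphi\in C_c^\infty(U)$ (so $D_{\rm id}v=\nabla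 v$), and $W^{\mathfrak L,p}(U;\mathbb R^m)=\{v\in L^p(U;\mathbb R^m): D_{\mathfrak L}v\in L^p(U;\mathbb R^{m\times n})\}$. A *$p$-core functional* is a map $\alpha_p:L^p_{\rm loc}(\mathbb R^n;\mathbb R^m)\times\mathcal G^D(\mathbb R^n)\to[0,\infty)$ such that, for all $u,v\in L^p_{\rm loc}(\mathbb R^n;\mathbb R^m)$ and $D'\in\mathcal G^D(\mathbb R^n)$: 1. $\alpha_p(u,D')=\alpha_p(v,D')$ if $u=v$ a.e. on $D'$; 2. $\alpha_p(\cdot,D')$ is convex; 3. $\alpha_p(tu,D')=|t|^p\alpha_p(u,D')$ for $t\in\mathbb R$; 4. $\alpha_p(u+h,D')=\alpha_p(u,D')$ for $h\in\mathbb R^m$; 5. $\alpha_p(u\circ F,D')=\alpha_p(u,F(D'))$ for $F\in\Gamma$; 6. there is $c_1>0$ with $\alpha_p(w,D)\le c_1\int_D|\nabla w|_2^p\,dx$ for all $w\in L^p_{\rm loc}(\mathbb R^n;\mathbb R^m)$ with $w|_D\in W^{1,p}(D;\mathbb R^m)$. It is *$L^p$-lsc* if the restriction of $\alpha_p(\cdot,D')$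 to $L^p(\mathbb R^n;\mathbb R^m)$ is lower semicontinuous for every $D'\in\mathcal G^D(\mathbb R^n)$. Put $$G_\varepsilon(u,\Omega)=\varepsilon^{n-p}\sup_{\mathcal F}\sum_{D'\in\mathcal F}\alpha_p(u,D'),$$ the supremum over all families $\mathcal F$ of pairwise disjoint elements of $\mathcal G^D_\varepsilon(\Omega)$ (it is $0$ if only $\mathcal F=\emptyset$ is possible). For $A\in\mathbb R^{m\times n}$ let $\psi_{\alpha_p}(A)=\lim_{\varepsilon\to0^+}G_\varepsilon\big(x\mapsto Ax,(-\tfrac12,\tfrac12)^n\big)$; this limit exists, and $\mathcal N=\{A:\psi_{\alpha_p}(A)=0\}$ is a linear subspace of $\mathbb R^{m\times n}$. For a linear complement $\mathcal P$ of $\mathcal N$, i.e. $\mathbb R^{m\times n}=\mathcal P\oplus\mathcal N$, let $\pi_{\mathcal P}$ be the projection onto $\mathcal P$ along $\mathcal N$. The $p$-core functional $\alpha_p$ is *strong* if for some such $\mathcal P$ there is $c_3>0$ with $\alpha_p(w,D)\le c_3\int_D|D_{\pi_{\mathcal P}}w|_2^p\,dx$ for all $w\in L^p_{\rm loc}(\mathbb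 R^n;\mathbb R^m)$ with $w|_D\in W^{\pi_{\mathcal P},p}(D;\mathbb R^m)$. **Theorem.** Let $\Omega\subseteq\mathbb R^n$ be open and connected, let $\alpha_p$ be an $L^p$-lsc $p$-core functional, and let $u\in L^p_{\rm loc}(\mathbb R^n;\mathbb R^m)$ satisfy $\liminf_{\varepsilon\to0^+}G_\varepsilon(u,\Omega)=0$. Then: (a) $D_{\pi_{\mathcal P}}(u|_\Omega)=0$ in the sense of distributions on $\Omega$, for every linear complement $\mathcal P$ of $\mathcal N$. (b) If $\psi_{\alpha_p}(A)>0$ for every $A\in\mathbb R^{m\times n}\setminus\{0\}$, then $\nabla (u|_\Omega)=0$ and $u$ is a.e. equal to a constant on $\Omega$. (c) If $\mathcal G=\{\mathrm{id}\}$ and $\alpha_p$ is strong, then $\alpha_p(u,D')=0$ for every $D'\in\mathcal G^D(\Omega)$. -/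

import Mathlib

open MeasureTheory Filter Topology
open scoped ENNReal NNReal ContDiff

namespace CoreBMO

/-- `ℝⁿ` with its Euclidean norm. -/
abbrev E (n : ℕ) := EuclideanSpace ℝ (Fin n)

/-- `ℝ^{m×n}`, as the space of linear maps `ℝⁿ → ℝᵐ`; its norm is the operator norm
`|A|₂ = sup {|A x|₂ : |x|₂ ≤ 1}` and the linear function `l^A` is `A` itself. -/
abbrev Mat (m n : ℕ) := E n →L[ℝ] E m

/-- `u ∈ L^p_loc(ℝⁿ; ℝᵐ)`. -/
def MemLpLoc {n m : ℕ} (p : ℝ) (u : E n → E m) : Prop :=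
  ∀ K : Set (E n), IsCompact K → MemLp u (ENNReal.ofReal p) (volume.restrict K)

/-! ### The distributions `D_𝔏 u` -/

/-- `φ ∈ C_c^∞(Ω)`. -/
structure IsTestFunction {n : ℕ} (Ω : Set (E n)) (φ : E n → ℝ) : Prop where
  contDiff : ContDiff ℝ ∞ φ
  hasCompactSupport : HasCompactSupport φ
  tsupport_subset : tsupport φ ⊆ Ω

/-- The pairing `⟨D_𝔏 u, φ⟩ = - ∫_Ω 𝔏(u ⊗ ∇φ) dx`, for `u` defined on `Ω`. Here `u ⊗ ∇φ` at `x` is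
the matrix `u_k(x) ∂_l φ(x)`, that is, the linear map `y ↦ (∇φ(x) · y) u(x)`. -/
noncomputable def pairingD {n m : ℕ} (L : Mat m n →ₗ[ℝ] Mat m n) (Ω : Set (E n)) (u : E n → E m)
    (φ : E n → ℝ) : Mat m n :=
  -∫ x in Ω, L ((fderiv ℝ φ x).smulRight (u x))

/-- `D_𝔏 (u|_Ω) = 0` as a (matrix of) distribution(s) on `Ω`. -/
def DEqZero {n m : ℕ} (L : Mat m n →ₗ[ℝ] Mat m n) (Ω : Set (E n)) (u : E n → E m) : Prop :=
  ∀ φ : E n → ℝ, IsTestFunction Ω φ → pairingD L Ω u φ = 0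

/-- `u|_Ω ∈ W^{𝔏,p}(Ω; ℝᵐ)`, with `D_𝔏 (u|_Ω)` represented by `g ∈ L^p(Ω; ℝ^{m×n})`. For `𝔏 = id`
this says that `u|_Ω ∈ W^{1,p}(Ω; ℝᵐ)` with weak gradient `g`. -/
structure IsSobolev {n m : ℕ} (L : Mat m n →ₗ[ℝ] Mat m n) (p : ℝ) (Ω : Set (E n))
    (u : E n → E m) (g : E n → Mat m n) : Prop where
  memLp : MemLp u (ENNReal.ofReal p) (volume.restrict Ω)
  memLp_grad : MemLp g (ENNReal.ofReal p) (volume.restrict Ω)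
  represents : ∀ φ : E n → ℝ, IsTestFunction Ω φ → ∫ x in Ω, φ x • g x = pairingD L Ω u φ

/-! ### Cells -/

/-- The class of all images `F(D) ⊆ Ω` with `F ∈ Γ`. -/
def cells {n : ℕ} (Γ : Set (E n ≃ᵃ[ℝ] E n)) (D Ω : Set (E n)) : Set (Set (E n)) :=
  {S | ∃ F ∈ Γ, F '' D = S ∧ F '' D ⊆ Ω}

/-- The affine maps `x ↦ ε R x + h` with `R ∈ 𝒢` and `h ∈ ℝⁿ`. -/
def gammaEps {n : ℕ} (𝒢 : Subgroup (Matrix.specialOrthogonalGroup (Fin n) ℝ)) (ε : ℝ) :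
    Set (E n ≃ᵃ[ℝ] E n) :=
  {F | ∃ R ∈ 𝒢, ∃ h : E n, ∀ x,
    F x = ε • Matrix.toEuclideanLin (R : Matrix (Fin n) (Fin n) ℝ) x + h}

/-- The group of the affine maps `x ↦ ε R x + h` with `ε > 0`, `R ∈ 𝒢` and `h ∈ ℝⁿ`. -/
def gamma {n : ℕ} (𝒢 : Subgroup (Matrix.specialOrthogonalGroup (Fin n) ℝ)) :
    Subgroup (E n ≃ᵃ[ℝ] E n) where
  carrier := {F | ∃ ε : ℝ, 0 < ε ∧ F ∈ gammaEps 𝒢 ε}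
  mul_mem' := by
    rintro F G ⟨ε, hε, R, hR, h, hF⟩ ⟨δ, hδ, S, hS, k, hG⟩
    refine ⟨ε * δ, mul_pos hε hδ, R * S, mul_mem hR hS,
      ε • Matrix.toEuclideanLin (R : Matrix (Fin n) (Fin n) ℝ) k + h, fun x => ?_⟩
    rw [AffineEquiv.mul_def, AffineEquiv.trans_apply, hG, hF]
    have : Matrix.toEuclideanLin ((R * S : Matrix.specialOrthogonalGroup (Fin n) ℝ) :
        Matrix (Fin n) (Fin n) ℝ) x
        = Matrix.toEuclideanLin (R : Matrix (Fin n) (Fin n) ℝ)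
          (Matrix.toEuclideanLin (S : Matrix (Fin n) (Fin n) ℝ) x) := by
      simp [Matrix.toLpLin_apply, Matrix.mulVec_mulVec]
    rw [this, map_add, map_smul, smul_add, smul_smul, add_assoc]
  one_mem' := ⟨1, one_pos, 1, one_mem _, 0, fun x => by simp⟩
  inv_mem' := by
    rintro F ⟨ε, hε, R, hR, h, hF⟩
    refine ⟨ε⁻¹, inv_pos.2 hε, R⁻¹, inv_mem hR,
      -(ε⁻¹ • Matrix.toEuclideanLin
        ((R⁻¹ : Matrix.specialOrthogonalGroup (Fin n) ℝ) : Matrix (Fin n) (Fin n) ℝ) h),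
      fun x => ?_⟩
    have key : ∀ y, Matrix.toEuclideanLin (R : Matrix (Fin n) (Fin n) ℝ)
        (Matrix.toEuclideanLin ((R⁻¹ : Matrix.specialOrthogonalGroup (Fin n) ℝ) :
          Matrix (Fin n) (Fin n) ℝ) y) = y := by
      intro y
      have h1 : (R : Matrix (Fin n) (Fin n) ℝ) *
          ((R⁻¹ : Matrix.specialOrthogonalGroup (Fin n) ℝ) : Matrix (Fin n) (Fin n) ℝ) = 1 := by
        rw [← Submonoid.coe_mul, mul_inv_cancel, Submonoid.coe_one]
      simp [Matrix.toLpLin_apply, Matrix.mulVec_mulVec, h1]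
    rw [AffineEquiv.inv_def, AffineEquiv.symm_apply_eq, hF, map_add, map_neg, map_smul, map_smul,
      key, key, smul_add, smul_neg, smul_smul, smul_smul, mul_inv_cancel₀ hε.ne']
    simp

/-! ### Core functionals -/

/-- `α : L^p_loc(ℝⁿ; ℝᵐ) × {F(D) : F ∈ Γ} → [0, ∞)` is a `p`-core functional subordinated to `D`,
`Γ` and `m`. The values of `α` outside of this domain are irrelevant, and `ext_indep` makes
`α · D'` a function of the almost everywhere class of `u` on `D'`. -/
structure IsCore {n m : ℕ} (p : ℝ) (D : Set (E n)) (Γ : Subgroup (E n ≃ᵃ[ℝ] E n))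
    (α : (E n → E m) → Set (E n) → ℝ≥0) : Prop where
  ext_indep : ∀ D' ∈ cells (Γ : Set (E n ≃ᵃ[ℝ] E n)) D Set.univ, ∀ u v : E n → E m,
    MemLpLoc p u → MemLpLoc p v → u =ᵐ[volume.restrict D'] v → α u D' = α v D'
  convex : ∀ D' ∈ cells (Γ : Set (E n ≃ᵃ[ℝ] E n)) D Set.univ, ∀ u v : E n → E m,
    MemLpLoc p u → MemLpLoc p v → ∀ a b : ℝ≥0, a + b = 1 →
      α (a • u + b • v) D' ≤ a * α u D' + b * α v D'
  homogeneous : ∀ D' ∈ cells (Γ : Set (E n ≃ᵃ[ℝ] E n)) D Set.univ, ∀ u : E n → E m,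
    MemLpLoc p u → ∀ t : ℝ, α (t • u) D' = ‖t‖₊ ^ p * α u D'
  add_const : ∀ D' ∈ cells (Γ : Set (E n ≃ᵃ[ℝ] E n)) D Set.univ, ∀ u : E n → E m,
    MemLpLoc p u → ∀ h : E m, α (fun x => u x + h) D' = α u D'
  change_var : ∀ D' ∈ cells (Γ : Set (E n ≃ᵃ[ℝ] E n)) D Set.univ, ∀ u : E n → E m,
    MemLpLoc p u → ∀ F ∈ Γ, α (u ∘ F) D' = α u (F '' D')
  grad_bound : ∃ c : ℝ≥0, 0 < c ∧ ∀ (u : E n → E m) (g : E n → Mat m n),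
    MemLpLoc p u → IsSobolev LinearMap.id p D u g →
      (α u D : ℝ≥0∞) ≤ c * ∫⁻ x in D, ‖g x‖ₑ ^ p

/-- The restriction of `α · D'` to `L^p(ℝⁿ; ℝᵐ)` is lower semicontinuous for every `D'` in
`{F(D) : F ∈ Γ}`. -/
def IsLpLsc {n m : ℕ} {p : ℝ} (hp : 1 ≤ p) (D : Set (E n)) (Γ : Subgroup (E n ≃ᵃ[ℝ] E n))
    (α : (E n → E m) → Set (E n) → ℝ≥0) : Prop :=
  haveI : Fact (1 ≤ ENNReal.ofReal p) := ⟨ENNReal.one_le_ofReal.2 hp⟩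
  ∀ D' ∈ cells (Γ : Set (E n ≃ᵃ[ℝ] E n)) D Set.univ,
    LowerSemicontinuous fun f : Lp (E m) (ENNReal.ofReal p) (volume : Measure (E n)) => α f D'

/-- The BMO-type seminorm `G_ε(u, Ω) = ε^{n-p} sup ∑ α(u, D')`, the supremum being over all families
`𝓕` of pairwise disjoint sets `D' ⊆ Ω` of the form `ε R D + h` with `R ∈ 𝒢`. -/
noncomputable def G {n m : ℕ} (p : ℝ) (D : Set (E n))
    (𝒢 : Subgroup (Matrix.specialOrthogonalGroup (Fin n) ℝ))
    (α : (E n → E m) → Set (E n) → ℝ≥0) (ε : ℝ) (u : E n → E m) (Ω : Set (E n)) : ℝ≥0∞ :=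
  ENNReal.ofReal (ε ^ ((n : ℝ) - p)) *
    ⨆ (𝓕 : Set (Set (E n))) (_ : 𝓕 ⊆ cells (gammaEps 𝒢 ε) D Ω) (_ : 𝓕.PairwiseDisjoint id),
      ∑' D' : 𝓕, (α u D' : ℝ≥0∞)

/-- `G_-(u, Ω) = liminf_{ε → 0⁺} G_ε(u, Ω)`. -/
noncomputable def Gminus {n m : ℕ} (p : ℝ) (D : Set (E n))
    (𝒢 : Subgroup (Matrix.specialOrthogonalGroup (Fin n) ℝ))
    (α : (E n → E m) → Set (E n) → ℝ≥0) (u : E n → E m) (Ω : Set (E n)) : ℝ≥0∞ :=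
  liminf (fun ε : ℝ => G p D 𝒢 α ε u Ω) (𝓝[>] 0)

/-- The unit cube `(-1/2, 1/2)ⁿ`. -/
def Q (n : ℕ) : Set (E n) := {x | ∀ i, x i ∈ Set.Ioo (-1 / 2 : ℝ) (1 / 2)}

/-- `ψ(A) = lim_{ε → 0⁺} G_ε(l^A, Q)`; the limit exists by `tendsto_psi`. -/
noncomputable def psi {n m : ℕ} (p : ℝ) (D : Set (E n))
    (𝒢 : Subgroup (Matrix.specialOrthogonalGroup (Fin n) ℝ))
    (α : (E n → E m) → Set (E n) → ℝ≥0) (A : Mat m n) : ℝ≥0∞ :=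
  limUnder (𝓝[>] (0 : ℝ)) fun ε => G p D 𝒢 α ε (⇑A) (Q n)

/-! ### The limit defining `ψ` exists, and the null set of `ψ` is a linear subspace -/

variable {n m : ℕ} {p : ℝ} {D : Set (E n)}
  {𝒢 : Subgroup (Matrix.specialOrthogonalGroup (Fin n) ℝ)}
  {α : (E n → E m) → Set (E n) → ℝ≥0}

lemma memLpLoc_clm (A : Mat m n) : MemLpLoc p (⇑A) := by
  intro K hK
  have : IsFiniteMeasure ((volume : Measure (E n)).restrict K) :=
    ⟨by simpa using hK.measure_lt_top⟩
  obtain ⟨C, hC⟩ := hK.exists_bound_of_continuousOn A.continuous.continuousOn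
  exact MemLp.of_bound A.continuous.aestronglyMeasurable C
    ((ae_restrict_iff' hK.measurableSet).2 (Eventually.of_forall hC))

lemma cells_gammaEps_subset {ε : ℝ} (hε : 0 < ε) (Ω : Set (E n)) :
    cells (gammaEps 𝒢 ε) D Ω ⊆ cells (gamma 𝒢 : Set (E n ≃ᵃ[ℝ] E n)) D Set.univ := by
  rintro S ⟨F, hF, hS, -⟩
  exact ⟨F, ⟨ε, hε, hF⟩, hS, Set.subset_univ _⟩

/-- `x ↦ s x + h`. -/
noncomputable def dil (n : ℕ) {s : ℝ} (hs : 0 < s) (h : E n) : E n ≃ᵃ[ℝ] E n :=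
  ((LinearEquiv.smulOfNeZero ℝ (E n) s hs.ne').toAffineEquiv).trans (AffineEquiv.constVAdd ℝ (E n) h)

lemma dil_apply {s : ℝ} (hs : 0 < s) (h x : E n) : dil n hs h x = s • x + h := by
  simp [dil, add_comm]

lemma dil_mem {s : ℝ} (hs : 0 < s) (h : E n) : dil n hs h ∈ gamma 𝒢 :=
  ⟨s, hs, 1, one_mem _, h, fun x => by rw [dil_apply]; simp⟩

lemma alpha_dil (hα : IsCore p D (gamma 𝒢) α) (A : Mat m n) {s : ℝ} (hs : 0 < s) (h : E n)
    {S : Set (E n)} (hS : S ∈ cells (gamma 𝒢 : Set (E n ≃ᵃ[ℝ] E n)) D Set.univ) :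
    α (⇑A) (dil n hs h '' S) = ‖s‖₊ ^ p * α (⇑A) S := by
  rw [← hα.change_var S hS _ (memLpLoc_clm A) _ (dil_mem hs h)]
  have : (⇑A ∘ ⇑(dil n hs h)) = fun x => (s • ⇑A) x + A h := by
    funext x
    simp [dil_apply]
  have h2 : MemLpLoc p (s • ⇑A) := memLpLoc_clm (s • A)
  rw [this, hα.add_const S hS _ h2, hα.homogeneous S hS _ (memLpLoc_clm A)]

/-- Center of one of the `kⁿ` cubes of side `1/k` that tile the unit cube. -/
noncomputable def ctr (k : ℕ) (i : Fin n → Fin k) : E n :=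
  WithLp.toLp 2 fun j => -1 / 2 + ((i j : ℕ) + 1 / 2 : ℝ) / k

lemma dil_ctr_bounds {k : ℕ} (hk : 0 < k) {s : ℝ} (hs : 0 < s) (hks : (k : ℝ) * s ≤ 1)
    (i : Fin n → Fin k) {x : E n} (hx : x ∈ Q n) (j : Fin n) :
    ((i j : ℕ) : ℝ) < k * (dil n hs (ctr k i) x j + 1 / 2) ∧
      (k : ℝ) * (dil n hs (ctr k i) x j + 1 / 2) < (i j : ℕ) + 1 := by
  have hk' : (0 : ℝ) < k := by exact_mod_cast hk
  have e : (k : ℝ) * (dil n hs (ctr k i) x j + 1 / 2) = (k * s) * x j + ((i j : ℕ) + 1 / 2) := by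
    rw [dil_apply]
    simp only [ctr, PiLp.add_apply, PiLp.smul_apply, smul_eq_mul]
    field_simp
    ring
  obtain ⟨h1, h2⟩ := hx j
  have hks0 : 0 < (k : ℝ) * s := mul_pos hk' hs
  rw [e]
  constructor <;> nlinarith

lemma dil_ctr_mem_Q {k : ℕ} (hk : 0 < k) {s : ℝ} (hs : 0 < s) (hks : (k : ℝ) * s ≤ 1)
    (i : Fin n → Fin k) {x : E n} (hx : x ∈ Q n) : dil n hs (ctr k i) x ∈ Q n := by
  intro j
  have hk' : (0 : ℝ) < k := by exact_mod_cast hk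
  obtain ⟨h1, h2⟩ := dil_ctr_bounds hk hs hks i hx j
  have h3 : ((i j : ℕ) : ℝ) + 1 ≤ k := by exact_mod_cast (i j).2
  have h4 : (0 : ℝ) ≤ ((i j : ℕ) : ℝ) := Nat.cast_nonneg _
  constructor
  · have : 0 < dil n hs (ctr k i) x j + 1 / 2 := by
      by_contra! hc
      nlinarith
    linarith
  · by_contra! hc
    nlinarith

lemma dil_ctr_inj {k : ℕ} (hk : 0 < k) {s : ℝ} (hs : 0 < s) (hks : (k : ℝ) * s ≤ 1)
    {i i' : Fin n → Fin k} {x x' : E n} (hx : x ∈ Q n) (hx' : x' ∈ Q n)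
    (h : dil n hs (ctr k i) x = dil n hs (ctr k i') x') : i = i' := by
  funext j
  obtain ⟨h1, h2⟩ := dil_ctr_bounds hk hs hks i hx j
  obtain ⟨h3, h4⟩ := dil_ctr_bounds hk hs hks i' hx' j
  rw [← h] at h3 h4
  have a1 : ((i j : ℕ) : ℝ) < ((i' j : ℕ) + 1 : ℕ) := by push_cast; linarith
  have a2 : ((i' j : ℕ) : ℝ) < ((i j : ℕ) + 1 : ℕ) := by push_cast; linarith
  have b1 := Nat.cast_lt.1 a1
  have b2 := Nat.cast_lt.1 a2
  exact Fin.ext (by omega)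

lemma le_G {ε : ℝ} {u : E n → E m} {Ω : Set (E n)} {𝓕 : Set (Set (E n))}
    (h1 : 𝓕 ⊆ cells (gammaEps 𝒢 ε) D Ω) (h2 : 𝓕.PairwiseDisjoint id) :
    ENNReal.ofReal (ε ^ ((n : ℝ) - p)) * ∑' D' : 𝓕, (α u D' : ℝ≥0∞) ≤ G p D 𝒢 α ε u Ω := by
  unfold G
  gcongr
  exact le_iSup₂_of_le 𝓕 h1 (le_iSup_of_le h2 le_rfl)

lemma G_le {ε : ℝ} {u : E n → E m} {Ω : Set (E n)} {a b : ℝ≥0∞}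
    (h : ∀ 𝓕 : Set (Set (E n)), 𝓕 ⊆ cells (gammaEps 𝒢 ε) D Ω → 𝓕.PairwiseDisjoint id →
      a * (ENNReal.ofReal (ε ^ ((n : ℝ) - p)) * ∑' D' : 𝓕, (α u D' : ℝ≥0∞)) ≤ b) :
    a * G p D 𝒢 α ε u Ω ≤ b := by
  unfold G
  simp only [ENNReal.mul_iSup]
  exact iSup_le fun 𝓕 => iSup_le fun h1 => iSup_le fun h2 => h 𝓕 h1 h2

lemma G_tile (hα : IsCore p D (gamma 𝒢) α) (hD : D.Nonempty) (A : Mat m n) {ε δ : ℝ}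
    (hε : 0 < ε) (hδ : 0 < δ) {k : ℕ} (hk : 0 < k) (hkδ : k * δ ≤ ε) :
    ENNReal.ofReal ((k * δ / ε) ^ n) * G p D 𝒢 α ε (⇑A) (Q n) ≤ G p D 𝒢 α δ (⇑A) (Q n) := by
  have hs : 0 < δ / ε := div_pos hδ hε
  set s := δ / ε with hs_def
  have hks : (k : ℝ) * s ≤ 1 := by
    rw [hs_def, ← mul_div_assoc]
    exact (div_le_one hε).2 hkδ
  refine G_le fun 𝓕 h1 h2 => ?_
  have hne : ∀ S ∈ 𝓕, S.Nonempty ∧ S ⊆ Q n := by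
    intro S hS
    obtain ⟨F, -, rfl, hQ⟩ := h1 hS
    exact ⟨hD.image _, hQ⟩
  let f : (Fin n → Fin k) × 𝓕 → Set (E n) := fun q => dil n hs (ctr k q.1) '' (q.2 : Set (E n))
  have hdisj : ∀ q q', ¬ Disjoint (f q) (f q') → q = q' := by
    rintro ⟨i, S, hS⟩ ⟨i', S', hS'⟩ hnd
    obtain ⟨y, ⟨x, hx, hxy⟩, ⟨x', hx', hxy'⟩⟩ := Set.not_disjoint_iff.1 hnd
    have hi : i = i' := dil_ctr_inj hk hs hks ((hne S hS).2 hx) ((hne S' hS').2 hx')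
      (hxy.trans hxy'.symm)
    subst hi
    have hxx : x = x' := (dil n hs (ctr k i)).injective (hxy.trans hxy'.symm)
    subst hxx
    have : S = S' := by
      by_contra hc
      exact Set.disjoint_left.1 (h2 hS hS' hc) hx hx'
    subst this
    rfl
  have hinj : Function.Injective f := by
    intro q q' hq
    refine hdisj q q' ?_
    rw [← hq, disjoint_self]
    exact (((hne _ q.2.2).1).image _).ne_empty
  have hsub : Set.range f ⊆ cells (gammaEps 𝒢 δ) D (Q n) := by
    rintro _ ⟨⟨i, S, hS⟩, rfl⟩
    obtain ⟨F, ⟨R, hR, h, hF⟩, hFS, hFQ⟩ := h1 hS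
    have himg : (dil n hs (ctr k i) * F) '' D = f ⟨i, S, hS⟩ := by
      simp only [f, ← hFS, Set.image_image]
      rfl
    refine ⟨dil n hs (ctr k i) * F, ⟨R, hR, s • h + ctr k i, fun x => ?_⟩, himg, ?_⟩
    · rw [AffineEquiv.mul_def, AffineEquiv.trans_apply, dil_apply, hF, smul_add, smul_smul,
        hs_def, div_mul_cancel₀ _ hε.ne', add_assoc]
    · rw [himg]
      rintro _ ⟨x, hx, rfl⟩
      exact dil_ctr_mem_Q hk hs hks i ((hne S hS).2 hx)
  have hpd : (Set.range f).PairwiseDisjoint id := by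
    rintro _ ⟨q, rfl⟩ _ ⟨q', rfl⟩ hqq
    by_contra hc
    exact hqq (by rw [hdisj q q' hc])
  refine le_trans (le_of_eq ?_) (le_G hsub hpd)
  rw [tsum_range (fun S => (α (⇑A) S : ℝ≥0∞)) hinj,
    show (∑' q : (Fin n → Fin k) × 𝓕, (α (⇑A) (f q) : ℝ≥0∞)) =
      ∑' (i : Fin n → Fin k) (S : 𝓕), (α (⇑A) (f (i, S)) : ℝ≥0∞) from ENNReal.tsum_prod']
  have hcell : ∀ (i : Fin n → Fin k) (S : 𝓕),
      (α (⇑A) (f (i, S)) : ℝ≥0∞) = ENNReal.ofReal (s ^ p) * (α (⇑A) S : ℝ≥0∞) := by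
    intro i S
    simp only [f]
    rw [alpha_dil hα A hs _ (cells_gammaEps_subset hε _ (h1 S.2)), ENNReal.coe_mul]
    congr 1
    rw [ENNReal.ofReal, ENNReal.coe_inj]
    ext
    rw [Real.coe_toNNReal _ (Real.rpow_nonneg hs.le _), NNReal.coe_rpow, coe_nnnorm,
      Real.norm_of_nonneg hs.le]
  simp_rw [hcell, ENNReal.tsum_mul_left]
  generalize (∑' S : 𝓕, (α (⇑A) S : ℝ≥0∞)) = T
  rw [tsum_fintype, Finset.sum_const, Finset.card_univ, Fintype.card_fun, Fintype.card_fin,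
    Fintype.card_fin, nsmul_eq_mul, ← mul_assoc, ← mul_assoc, ← mul_assoc]
  congr 1
  have hk' : (0 : ℝ) ≤ k := Nat.cast_nonneg _
  rw [← ENNReal.ofReal_mul (by positivity), ← ENNReal.ofReal_natCast,
    ← ENNReal.ofReal_mul (by positivity), ← ENNReal.ofReal_mul (by positivity)]
  congr 1
  rw [Real.rpow_sub hε, Real.rpow_sub hδ, Real.rpow_natCast, Real.rpow_natCast, hs_def,
    Real.div_rpow hδ.le hε.le]
  have := (Real.rpow_pos_of_pos hε p).ne'
  have := (Real.rpow_pos_of_pos hδ p).ne'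
  field_simp
  rw [div_pow, mul_pow, div_mul_cancel₀ _ (pow_ne_zero n hε.ne'), mul_comm]
  push_cast
  rfl

lemma alpha_empty (hα : IsCore p D (gamma 𝒢) α) (hp : 1 ≤ p) (A : Mat m n)
    (h : (∅ : Set (E n)) ∈ cells (gamma 𝒢 : Set (E n ≃ᵃ[ℝ] E n)) D Set.univ) :
    α (⇑A) ∅ = 0 := by
  have h0 := hα.homogeneous ∅ h _ (memLpLoc_clm A) 0
  rw [nnnorm_zero, NNReal.zero_rpow (by linarith), zero_mul] at h0
  rw [← h0]
  have h2 : MemLpLoc p ((0 : ℝ) • ⇑A) := memLpLoc_clm ((0 : ℝ) • A)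
  exact hα.ext_indep ∅ h _ _ (memLpLoc_clm A) h2 (by simp [Filter.EventuallyEq])

lemma G_le_liminf (hα : IsCore p D (gamma 𝒢) α) (hp : 1 ≤ p) (A : Mat m n) {ε : ℝ}
    (hε : 0 < ε) :
    G p D 𝒢 α ε (⇑A) (Q n) ≤ liminf (fun δ : ℝ => G p D 𝒢 α δ (⇑A) (Q n)) (𝓝[>] 0) := by
  rcases D.eq_empty_or_nonempty with rfl | hD
  · refine le_trans (le_of_eq ?_) zero_le
    rw [← nonpos_iff_eq_zero, ← one_mul (G _ _ _ _ _ _ _)]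
    refine G_le fun 𝓕 h1 _ => ?_
    have : ∀ S : 𝓕, (α (⇑A) S : ℝ≥0∞) = 0 := by
      rintro ⟨S, hS⟩
      have h3 := cells_gammaEps_subset hε _ (h1 hS)
      have h4 : S = ∅ := by
        obtain ⟨F, -, h5, -⟩ := h1 hS
        simpa using h5.symm
      subst h4
      simpa using alpha_empty hα hp A h3
    simp [this]
  · have hfl : Tendsto (fun δ : ℝ => (⌊ε * δ⁻¹⌋₊ : ℝ) / δ⁻¹) (𝓝[>] 0) (𝓝 ε) :=
      (tendsto_nat_floor_mul_div_atTop hε.le).comp tendsto_inv_nhdsGT_zero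
    have ha : Tendsto (fun δ : ℝ => ENNReal.ofReal (((⌊ε * δ⁻¹⌋₊ : ℝ) * δ / ε) ^ n)) (𝓝[>] 0)
        (𝓝 1) := by
      have h1 : Tendsto (fun δ : ℝ => ((⌊ε * δ⁻¹⌋₊ : ℝ) * δ / ε) ^ n) (𝓝[>] 0)
          (𝓝 ((ε / ε) ^ n)) := by
        refine ((hfl.div_const ε).pow n).congr fun δ => ?_
        rw [div_inv_eq_mul]
      rw [div_self hε.ne', one_pow] at h1
      simpa using ENNReal.tendsto_ofReal h1
    have hb := ENNReal.Tendsto.mul_const (b := G p D 𝒢 α ε (⇑A) (Q n)) ha (Or.inl one_ne_zero)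
    rw [one_mul] at hb
    rw [← hb.liminf_eq]
    refine liminf_le_liminf ?_
    have hev : ∀ᶠ δ : ℝ in 𝓝[>] 0, δ ∈ Set.Ioc 0 ε := Ioc_mem_nhdsGT hε
    filter_upwards [hev] with δ hδ
    have h1 : (1 : ℝ) ≤ ε * δ⁻¹ := by
      rw [← div_eq_mul_inv]
      exact (one_le_div hδ.1).2 hδ.2
    refine G_tile hα hD A hε hδ.1 (Nat.floor_pos.2 h1) ?_
    have h2 := Nat.floor_le (le_trans zero_le_one h1)
    calc (⌊ε * δ⁻¹⌋₊ : ℝ) * δ ≤ ε * δ⁻¹ * δ := by gcongr; exact hδ.1.le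
      _ = ε := by rw [mul_assoc, inv_mul_cancel₀ hδ.1.ne', mul_one]

/-- The limit in the definition of `psi` exists. -/
theorem tendsto_psi (hα : IsCore p D (gamma 𝒢) α) (hp : 1 ≤ p) (A : Mat m n) :
    Tendsto (fun ε : ℝ => G p D 𝒢 α ε (⇑A) (Q n)) (𝓝[>] 0) (𝓝 (psi p D 𝒢 α A)) := by
  refine tendsto_nhds_limUnder
    ⟨liminf (fun δ : ℝ => G p D 𝒢 α δ (⇑A) (Q n)) (𝓝[>] 0), ?_⟩
  refine tendsto_of_le_liminf_of_limsup_le le_rfl ?_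
  refine limsup_le_of_le (h := ?_)
  filter_upwards [self_mem_nhdsWithin] with ε hε
  exact G_le_liminf hα hp A hε

lemma psi_zero (hα : IsCore p D (gamma 𝒢) α) (hp : 1 ≤ p) : psi p D 𝒢 α (0 : Mat m n) = 0 := by
  refine tendsto_nhds_unique (tendsto_psi hα hp 0) (tendsto_const_nhds.congr' ?_)
  filter_upwards [self_mem_nhdsWithin] with ε hε
  symm
  rw [← nonpos_iff_eq_zero, ← one_mul (G _ _ _ _ _ _ _)]
  refine G_le fun 𝓕 h1 _ => ?_
  have : ∀ S : 𝓕, (α (⇑(0 : Mat m n)) S : ℝ≥0∞) = 0 := by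
    intro S
    have h0 := hα.homogeneous S (cells_gammaEps_subset hε _ (h1 S.2)) _
      (memLpLoc_clm (0 : Mat m n)) 0
    rw [nnnorm_zero, NNReal.zero_rpow (by linarith), zero_mul] at h0
    rw [show (⇑(0 : Mat m n)) = (0 : ℝ) • ⇑(0 : Mat m n) by funext x; simp, h0]
    rfl
  rw [ENNReal.tsum_eq_zero.2 this, mul_zero, mul_zero]

lemma psi_smul_eq_zero (hα : IsCore p D (gamma 𝒢) α) (hp : 1 ≤ p) (t : ℝ) {A : Mat m n}
    (hA : psi p D 𝒢 α A = 0) : psi p D 𝒢 α (t • A) = 0 := by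
  have h := ENNReal.Tendsto.const_mul (a := ((‖t‖₊ ^ p : ℝ≥0) : ℝ≥0∞)) (tendsto_psi hα hp A)
    (Or.inr ENNReal.coe_ne_top)
  rw [hA, mul_zero] at h
  rw [← nonpos_iff_eq_zero]
  refine le_of_tendsto_of_tendsto (tendsto_psi hα hp (t • A)) h ?_
  filter_upwards [self_mem_nhdsWithin] with ε hε
  rw [← one_mul (G _ _ _ _ _ (⇑(t • A)) _)]
  refine G_le fun 𝓕 h1 h2 => ?_
  have : ∀ S : 𝓕, (α (⇑(t • A)) S : ℝ≥0∞) = ((‖t‖₊ ^ p : ℝ≥0) : ℝ≥0∞) * (α (⇑A) S : ℝ≥0∞) := by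
    intro S
    rw [← ENNReal.coe_mul]
    exact congrArg _ (hα.homogeneous S (cells_gammaEps_subset hε _ (h1 S.2)) _ (memLpLoc_clm A) t)
  simp_rw [this, ENNReal.tsum_mul_left]
  rw [one_mul, mul_left_comm]
  gcongr
  exact le_G h1 h2

lemma psi_add_eq_zero (hα : IsCore p D (gamma 𝒢) α) (hp : 1 ≤ p) {A B : Mat m n}
    (hA : psi p D 𝒢 α A = 0) (hB : psi p D 𝒢 α B = 0) : psi p D 𝒢 α (A + B) = 0 := by
  have hA' := psi_smul_eq_zero hα hp 2 hA
  have hB' := psi_smul_eq_zero hα hp 2 hB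
  have h := (tendsto_psi hα hp ((2 : ℝ) • A)).add (tendsto_psi hα hp ((2 : ℝ) • B))
  rw [hA', hB', add_zero] at h
  rw [← nonpos_iff_eq_zero]
  refine le_of_tendsto_of_tendsto (tendsto_psi hα hp (A + B)) h ?_
  filter_upwards [self_mem_nhdsWithin] with ε hε
  rw [← one_mul (G _ _ _ _ _ (⇑(A + B)) _)]
  refine G_le fun 𝓕 h1 h2 => ?_
  have : ∀ S : 𝓕, (α (⇑(A + B)) S : ℝ≥0∞) ≤
      (α (⇑((2 : ℝ) • A)) S : ℝ≥0∞) + (α (⇑((2 : ℝ) • B)) S : ℝ≥0∞) := by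
    intro S
    have h3 := hα.convex S (cells_gammaEps_subset hε _ (h1 S.2)) _ _
      (memLpLoc_clm ((2 : ℝ) • A)) (memLpLoc_clm ((2 : ℝ) • B)) 2⁻¹ 2⁻¹
      (by rw [← two_mul, mul_inv_cancel₀ two_ne_zero])
    have e : ((2⁻¹ : ℝ≥0) • ⇑((2 : ℝ) • A) + (2⁻¹ : ℝ≥0) • ⇑((2 : ℝ) • B)) = ⇑(A + B) := by
      funext x
      simp [NNReal.smul_def, smul_smul]
    rw [e] at h3
    have h4 : (2⁻¹ : ℝ≥0) ≤ 1 := inv_le_one_of_one_le₀ one_le_two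
    have h5 := h3.trans (add_le_add (mul_le_of_le_one_left zero_le h4)
      (mul_le_of_le_one_left zero_le h4))
    exact_mod_cast h5
  rw [one_mul]
  calc _ ≤ ENNReal.ofReal (ε ^ ((n : ℝ) - p)) * ∑' S : 𝓕,
        ((α (⇑((2 : ℝ) • A)) S : ℝ≥0∞) + (α (⇑((2 : ℝ) • B)) S : ℝ≥0∞)) := by
        gcongr with S
        exact this S
    _ ≤ _ := by
        rw [ENNReal.tsum_add, mul_add]
        exact add_le_add (le_G h1 h2) (le_G h1 h2)

/-- The linear subspace `𝒩_ψ = {A : ψ(A) = 0}` of `ℝ^{m×n}`. -/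
def nullSpace (hα : IsCore p D (gamma 𝒢) α) (hp : 1 ≤ p) : Submodule ℝ (Mat m n) where
  carrier := {A | psi p D 𝒢 α A = 0}
  add_mem' := fun hA hB => psi_add_eq_zero hα hp hA hB
  zero_mem' := psi_zero hα hp
  smul_mem' := fun t _ hA => psi_smul_eq_zero hα hp t hA

/-- The `p`-core functional `α` is strong: for some complement `P` of `𝒩_ψ`, with `π_P` the projection
onto `P` along `𝒩_ψ`, `α(u, D)` is bounded by `c ∫_D |D_{π_P} u|₂^p` for all `u ∈ L^p_loc(ℝⁿ; ℝᵐ)`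
with `u|_D ∈ W^{π_P,p}(D; ℝᵐ)`. -/
def IsStrong (hα : IsCore p D (gamma 𝒢) α) (hp : 1 ≤ p) : Prop :=
  ∃ (P : Submodule ℝ (Mat m n)) (hP : IsCompl P (nullSpace hα hp)) (c : ℝ≥0), 0 < c ∧
    ∀ (u : E n → E m) (g : E n → Mat m n), MemLpLoc p u →
      IsSobolev (P.projection (nullSpace hα hp) hP) p D u g →
        (α u D : ℝ≥0∞) ≤ c * ∫⁻ x in D, ‖g x‖ₑ ^ p

end CoreBMO

namespace CoreBMO

variable {n m : ℕ} {p : ℝ} {D : Set (E n)}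
  {𝒢 : Subgroup (Matrix.specialOrthogonalGroup (Fin n) ℝ)}
  {α : (E n → E m) → Set (E n) → ℝ≥0}

/-! The core of the proof is that `⟨∇u, φ⟩` is a null matrix of `psi`, for every test function `φ`
on `Ω`. This pairing equals `∇(ρ * f)(0)`, where `ρ(t) = φ(-t)` and `f` is `u` cut off outside a
large ball, so it suffices to show `psi A = 0` for `A = ∇v(0)`, `v = ρ * f`.

Two estimates on a small cube `sQ` give this. First, `v` is an `L^p`-valued integral of translates
of `f`. Sums of `α` over cells are convex and lower semicontinuous, so a Jensen inequality
(`tsum_alpha_convolution_le`) bounds the oscillation of `v` on `sQ` by a constant times that of `u`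
on `Ω`, which tends to zero along some scales. Secondly, `A - v` has gradient at most `η` on `sQ`
when `s` is small, so by the gradient bound its oscillation is at most a constant times `η ^ p s ^
n` (`tsum_alpha_le_of_norm_fderiv_le`). Since `α` scales exactly on linear maps, the two add up to a
bound of `psi A` by a multiple of `η ^ p` (`G_clm_le`, `psi_fderiv_convolution_eq_zero`), and `η` is
arbitrary.

Any linear map that kills the null space therefore kills the distributional gradient: `π_P` in (a),
the identity in (b), where mollification and connectedness then make `u` constant. In (c) each cell
is a dilated translate of `D`. Pulling `u` back to `D` keeps `D_{π_P}` equal to zero, and the strong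
bound applies with zero right-hand side. -/

lemma memLpLoc_of_continuous {f : E n → E m} (hf : Continuous f) : MemLpLoc p f := by
  intro K hK
  have : IsFiniteMeasure ((volume : Measure (E n)).restrict K) :=
    ⟨by simpa using hK.measure_lt_top⟩
  obtain ⟨C, hC⟩ := hK.exists_bound_of_continuousOn hf.continuousOn
  exact MemLp.of_bound hf.aestronglyMeasurable C
    ((ae_restrict_iff' hK.measurableSet).2 (Eventually.of_forall hC))

lemma memLpLoc_of_memLp {f : E n → E m} (hf : MemLp f (ENNReal.ofReal p)) : MemLpLoc p f :=
  fun _ _ => hf.restrict _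

/-! ### Convolutions as Bochner integrals of translates -/

section Translates

variable {q : ℝ≥0∞} [Fact (1 ≤ q)]

/-- Translation is continuous in `L^q` only for finite `q`; this is what makes the Bochner integral
below meaningful. -/
lemma continuous_smul_translate [Fact (q ≠ ⊤)] {ρ : E n → ℝ} (hρ : Continuous ρ)
    (f : Lp (E m) q (volume : Measure (E n))) :
    Continuous fun t : E n => ρ t • (DomAddAct.mk (-t) +ᵥ f) :=
  hρ.smul ((DomAddAct.continuous_mk.comp continuous_neg).vadd continuous_const)

/-- Point evaluation is not available on `L^q`, so the two sides are compared through their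
integrals over sets of finite measure, which are continuous functionals; Fubini then exchanges the
two integrations. -/
lemma convolution_ae_eq_integral_translate [Fact (q ≠ ⊤)] {f : E n → E m} (hf : MemLp f q volume)
    (hf1 : Integrable f) {ρ : E n → ℝ} (hρ : Continuous ρ) (hρc : HasCompactSupport ρ) :
    ⇑(∫ t, ρ t • (DomAddAct.mk (-t) +ᵥ hf.toLp f) : Lp (E m) q (volume : Measure (E n)))
      =ᵐ[volume] convolution ρ f (ContinuousLinearMap.lsmul ℝ ℝ) volume := by
  have hint : Integrable fun t : E n => ρ t • (DomAddAct.mk (-t) +ᵥ hf.toLp f) :=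
    (continuous_smul_translate hρ _).integrable_of_hasCompactSupport hρc.smul_right
  have hρ1 : Integrable ρ := hρ.integrable_of_hasCompactSupport hρc
  have hprod := hρ1.convolution_integrand (ContinuousLinearMap.lsmul ℝ ℝ) hf1
  refine ae_eq_of_forall_setIntegral_eq_of_sigmaFinite
    (fun s hs hs' => integrableOn_Lp_of_measure_ne_top _ Fact.out hs'.ne)
    (fun s hs hs' => (hρ1.integrable_convolution _ hf1).integrableOn) fun s hs hs' => ?_
  let q' := ENNReal.conjExponent q
  have : Fact (1 ≤ q') := ⟨ENNReal.HolderConjugate.one_le q' q⟩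
  -- Integration over `s` as a bounded operator, by Hölder pairing with the indicator of `s` in the
  -- conjugate space.
  let T : Lp (E m) q (volume : Measure (E n)) →L[ℝ] E m :=
    (ContinuousLinearMap.lpPairing volume q q' (ContinuousLinearMap.lsmul ℝ ℝ).flip).flip
      (indicatorConstLp q' hs hs'.ne (1 : ℝ))
  have hT : ∀ g : Lp (E m) q (volume : Measure (E n)), T g = ∫ x in s, g x := by
    intro g
    simp only [T, ContinuousLinearMap.flip_apply]
    rw [ContinuousLinearMap.lpPairing_eq_integral, ← integral_indicator hs]
    refine integral_congr_ae ?_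
    filter_upwards [indicatorConstLp_coeFn (p := q') (hs := hs) (hμs := hs'.ne) (c := (1 : ℝ))]
      with x hx
    rw [hx]
    by_cases h : x ∈ s <;> simp [h]
  rw [← hT, ← ContinuousLinearMap.integral_comp_comm T hint]
  have h1 : ∀ t : E n, T (ρ t • (DomAddAct.mk (-t) +ᵥ hf.toLp f)) =
      ∫ x in s, ρ t • f (x - t) := by
    intro t
    rw [map_smul, hT, integral_smul]
    congr 1
    refine integral_congr_ae (ae_restrict_of_ae ?_)
    rw [DomAddAct.mk_vadd_toLp]
    filter_upwards [MemLp.coeFn_toLp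
      (hf.comp_measurePreserving <| measurePreserving_vadd (-t) volume)] with x hx
    refine hx.trans ?_
    rw [Function.comp_apply, vadd_eq_add, neg_add_eq_sub]
  simp_rw [h1]
  symm
  simp only [convolution]
  refine integral_integral_swap (μ := volume.restrict s) (ν := volume)
    (f := fun x t => ρ t • f (x - t)) ?_
  have h2 := hprod.restrict (s := s ×ˢ Set.univ)
  rw [← Measure.prod_restrict, Measure.restrict_univ] at h2
  exact h2

end Translates

/-! ### Jensen's inequality for sums of `α` over cells -/

lemma MemLpLoc.add {u v : E n → E m} (hu : MemLpLoc p u) (hv : MemLpLoc p v) :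
    MemLpLoc p (u + v) := fun K hK => (hu K hK).add (hv K hK)

lemma MemLpLoc.const_smul {u : E n → E m} (hu : MemLpLoc p u) (t : ℝ) :
    MemLpLoc p (t • u) := fun K hK => (hu K hK).const_smul t

lemma IsCore.congr_ae (hα : IsCore p D (gamma 𝒢) α) {S : Set (E n)}
    (hS : S ∈ cells (gamma 𝒢 : Set (E n ≃ᵃ[ℝ] E n)) D Set.univ) {u v : E n → E m}
    (hu : MemLpLoc p u) (hv : MemLpLoc p v) (h : u =ᵐ[volume] v) : α u S = α v S :=
  hα.ext_indep S hS u v hu hv (ae_restrict_of_ae h)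

lemma convex_setOf_tsum_le (hα : IsCore p D (gamma 𝒢) α) [Fact (1 ≤ ENNReal.ofReal p)]
    {ι : Type*} {S : ι → Set (E n)}
    (hS : ∀ i, S i ∈ cells (gamma 𝒢 : Set (E n ≃ᵃ[ℝ] E n)) D Set.univ) (M : ℝ≥0∞) :
    Convex ℝ {g : Lp (E m) (ENNReal.ofReal p) (volume : Measure (E n)) |
      ∑' i, (α g (S i) : ℝ≥0∞) ≤ M} := by
  intro g hg h hh a b ha hb hab
  lift a to ℝ≥0 using ha
  lift b to ℝ≥0 using hb
  have hab' : a + b = 1 := by exact_mod_cast hab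
  have hgL := memLpLoc_of_memLp (Lp.memLp g)
  have hhL := memLpLoc_of_memLp (Lp.memLp h)
  have hi : ∀ i, (α ⇑((a : ℝ) • g + (b : ℝ) • h) (S i) : ℝ≥0∞) ≤
      a * (α g (S i) : ℝ≥0∞) + b * (α h (S i) : ℝ≥0∞) := by
    intro i
    have e : α ⇑((a : ℝ) • g + (b : ℝ) • h) (S i) = α (a • ⇑g + b • ⇑h) (S i) := by
      refine hα.congr_ae (hS i) (memLpLoc_of_memLp (Lp.memLp _))
        ((hgL.const_smul a).add (hhL.const_smul b)) ?_
      filter_upwards [Lp.coeFn_add ((a : ℝ) • g) ((b : ℝ) • h), Lp.coeFn_smul (a : ℝ) g,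
        Lp.coeFn_smul (b : ℝ) h] with x h1 h2 h3
      rw [h1, Pi.add_apply, h2, h3]
      rfl
    rw [e]
    exact_mod_cast hα.convex (S i) (hS i) g h hgL hhL a b hab'
  calc ∑' i, (α ⇑((a : ℝ) • g + (b : ℝ) • h) (S i) : ℝ≥0∞)
      ≤ ∑' i, (a * (α g (S i) : ℝ≥0∞) + b * (α h (S i) : ℝ≥0∞)) := ENNReal.tsum_le_tsum hi
    _ = a * ∑' i, (α g (S i) : ℝ≥0∞) + b * ∑' i, (α h (S i) : ℝ≥0∞) := by
        rw [ENNReal.tsum_add, ENNReal.tsum_mul_left, ENNReal.tsum_mul_left]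
    _ ≤ a * M + b * M := by
        gcongr
        · exact hg
        · exact hh
    _ = M := by rw [← add_mul, ← ENNReal.coe_add, hab', ENNReal.coe_one, one_mul]

/-- Lower semicontinuity survives arbitrary sums of nonnegative terms, so infinite families of cells
need no separate limit. -/
lemma isClosed_setOf_tsum_le {hp : 1 ≤ p} (hlsc : IsLpLsc hp D (gamma 𝒢) α)
    [Fact (1 ≤ ENNReal.ofReal p)] {ι : Type*} {S : ι → Set (E n)}
    (hS : ∀ i, S i ∈ cells (gamma 𝒢 : Set (E n ≃ᵃ[ℝ] E n)) D Set.univ) (M : ℝ≥0∞) :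
    IsClosed {g : Lp (E m) (ENNReal.ofReal p) (volume : Measure (E n)) |
      ∑' i, (α g (S i) : ℝ≥0∞) ≤ M} := by
  have : LowerSemicontinuous fun g : Lp (E m) (ENNReal.ofReal p) (volume : Measure (E n)) =>
      ∑' i, (α g (S i) : ℝ≥0∞) :=
    lowerSemicontinuous_tsum fun i => ENNReal.continuous_coe.comp_lowerSemicontinuous
      (hlsc (S i) (hS i)) ENNReal.coe_mono
  exact this.isClosed_preimage M

/-- Jensen's inequality for convolutions. -/
theorem tsum_alpha_convolution_le (hα : IsCore p D (gamma 𝒢) α) {hp : 1 ≤ p}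
    (hlsc : IsLpLsc hp D (gamma 𝒢) α) {ρ : E n → ℝ} (hρ : Continuous ρ)
    (hρc : HasCompactSupport ρ) :
    ∃ C : ℝ≥0, ∀ f : E n → E m, MemLp f (ENNReal.ofReal p) volume → Integrable f →
      ∀ (ι : Type) (S : ι → Set (E n)),
        (∀ i, S i ∈ cells (gamma 𝒢 : Set (E n ≃ᵃ[ℝ] E n)) D Set.univ) → ∀ M : ℝ≥0∞,
          (∀ t ∈ tsupport ρ, ∑' i, (α (fun x => f (x - t)) (S i) : ℝ≥0∞) ≤ M) →
            ∑' i, (α (convolution ρ f (ContinuousLinearMap.lsmul ℝ ℝ) volume) (S i) : ℝ≥0∞)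
              ≤ C * M := by
  have hp0 : p ≠ 0 := by linarith
  have : Fact (1 ≤ ENNReal.ofReal p) := ⟨ENNReal.one_le_ofReal.2 hp⟩
  have : Fact (ENNReal.ofReal p ≠ ⊤) := ⟨ENNReal.ofReal_ne_top⟩
  obtain ⟨B, hB⟩ := hρ.bounded_above_of_compact_support hρc
  obtain ⟨R, hR⟩ := hρc.isCompact.isBounded.subset_closedBall (0 : E n)
  -- The radius is at least `1` so that `K` has positive volume even when the support of `ρ` is
  -- empty or a bounding radius is not positive.
  set K : Set (E n) := Metric.closedBall 0 (max R 1) with hK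
  have hRK : tsupport ρ ⊆ K := hR.trans (Metric.closedBall_subset_closedBall (le_max_left _ _))
  have hK0 : volume K ≠ 0 :=
    (Metric.measure_closedBall_pos volume _ (lt_of_lt_of_le one_pos (le_max_right _ _))).ne'
  have hKt : volume K ≠ ⊤ := (isCompact_closedBall _ _).measure_lt_top.ne
  set a : ℝ := volume.real K with ha
  have ha0 : a ≠ 0 := (ENNReal.toReal_pos hK0 hKt).ne'
  -- The kernel may change sign and need not have mass one. The convolution is written as the
  -- average over `K` of `a ρ(t)` times the translates, and homogeneity turns the factor `a ρ(t)`
  -- into at most this constant.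
  refine ⟨(‖a‖₊ * B.toNNReal) ^ p, fun f hf hf1 ι S hS M hM => ?_⟩
  set C : ℝ≥0 := (‖a‖₊ * B.toNNReal) ^ p with hC
  let T : E n → Lp (E m) (ENNReal.ofReal p) (volume : Measure (E n)) :=
    fun t => ρ t • (DomAddAct.mk (-t) +ᵥ hf.toLp f)
  have hTc : Continuous T := continuous_smul_translate hρ _
  -- The average of a function with values in a closed convex set stays in that set.
  have hmem : (⨍ t in K, a • T t) ∈ {g : Lp (E m) (ENNReal.ofReal p) (volume : Measure (E n)) |
      ∑' i, (α g (S i) : ℝ≥0∞) ≤ C * M} := by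
    refine (convex_setOf_tsum_le hα hS _).set_average_mem (isClosed_setOf_tsum_le hlsc hS _)
      hK0 hKt (Eventually.of_forall fun t => ?_)
      ((hTc.const_smul a).continuousOn.integrableOn_compact (isCompact_closedBall _ _))
    have hft : MemLp (fun x => f (x - t)) (ENNReal.ofReal p) volume :=
      hf.comp_measurePreserving (measurePreserving_sub_right volume t)
    have hae : ⇑(a • T t) =ᵐ[volume] (a * ρ t) • fun x => f (x - t) := by
      simp only [T, smul_smul]
      rw [DomAddAct.mk_vadd_toLp]
      filter_upwards [Lp.coeFn_smul (a * ρ t) (MemLp.toLp (fun x => f (-t +ᵥ x))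
          (hf.comp_measurePreserving <| measurePreserving_vadd (-t) volume)),
        MemLp.coeFn_toLp (hf.comp_measurePreserving <| measurePreserving_vadd (-t) volume)]
        with x h1 h2
      rw [h1, Pi.smul_apply, Pi.smul_apply]
      congr 1
      refine h2.trans ?_
      rw [Function.comp_apply, vadd_eq_add, neg_add_eq_sub]
    have hi : ∀ i, (α ⇑(a • T t) (S i) : ℝ≥0∞) =
        ((‖a * ρ t‖₊ ^ p : ℝ≥0) : ℝ≥0∞) * (α (fun x => f (x - t)) (S i) : ℝ≥0∞) := by
      intro i
      rw [hα.congr_ae (hS i) (memLpLoc_of_memLp (Lp.memLp _))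
        ((memLpLoc_of_memLp hft).const_smul _) hae,
        hα.homogeneous (S i) (hS i) _ (memLpLoc_of_memLp hft), ENNReal.coe_mul]
    rw [Set.mem_ofPred_eq, tsum_congr hi, ENNReal.tsum_mul_left]
    -- Off the support `hM` says nothing, but there the integrand is zero and `0 ^ p = 0`.
    by_cases ht : t ∈ tsupport ρ
    · gcongr
      · rw [hC, nnnorm_mul]
        gcongr
        rw [← norm_toNNReal]
        exact Real.toNNReal_le_toNNReal (hB t)
      · exact hM t ht
    · rw [image_eq_zero_of_notMem_tsupport ht]
      simp [hp0, NNReal.zero_rpow]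
  have hav : (⨍ t in K, a • T t) = ∫ t, T t := by
    rw [setAverage_eq, integral_smul, smul_smul, inv_mul_cancel₀ ha0, one_smul]
    refine setIntegral_eq_integral_of_forall_compl_eq_zero fun t ht => ?_
    simp only [T]
    rw [image_eq_zero_of_notMem_tsupport fun h => ht (hRK h), zero_smul]
  rw [hav, Set.mem_ofPred_eq] at hmem
  refine le_trans (ENNReal.tsum_le_tsum fun i => ?_) hmem
  refine le_of_eq (congrArg _ (hα.congr_ae (hS i) ?_ (memLpLoc_of_memLp (Lp.memLp _)) ?_))
  · exact memLpLoc_of_continuous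
      (hρc.continuous_convolution_left _ hρ hf1.locallyIntegrable)
  · exact (convolution_ae_eq_integral_translate hf hf1 hρ hρc).symm

/-! ### Geometry of the cells -/

lemma norm_toEuclideanLin_specialOrthogonal (R : Matrix.specialOrthogonalGroup (Fin n) ℝ)
    (x : E n) : ‖Matrix.toEuclideanLin (R : Matrix (Fin n) (Fin n) ℝ) x‖ = ‖x‖ := by
  have h1 : ((R : Matrix (Fin n) (Fin n) ℝ)).conjTranspose * (R : Matrix (Fin n) (Fin n) ℝ) = 1 :=
    (Matrix.mem_unitaryGroup_iff').1 (Matrix.mem_specialOrthogonalGroup_iff.1 R.2).1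
  rw [Matrix.conjTranspose_eq_transpose_of_trivial] at h1
  have h2 : Matrix.toEuclideanLin ((R : Matrix (Fin n) (Fin n) ℝ)).conjTranspose
      (Matrix.toEuclideanLin (R : Matrix (Fin n) (Fin n) ℝ) x) = x := by
    simp [Matrix.toLpLin_apply, Matrix.mulVec_mulVec, h1]
  have h3 : inner ℝ (Matrix.toEuclideanLin (R : Matrix (Fin n) (Fin n) ℝ) x)
      (Matrix.toEuclideanLin (R : Matrix (Fin n) (Fin n) ℝ) x) = inner ℝ x x := by
    rw [← LinearMap.adjoint_inner_right, ← Matrix.toEuclideanLin_conjTranspose_eq_adjoint, h2]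
  rw [real_inner_self_eq_norm_sq, real_inner_self_eq_norm_sq] at h3
  exact (sq_eq_sq₀ (norm_nonneg _) (norm_nonneg _)).1 h3

/-- The isometry of `ℝⁿ` given by a special orthogonal matrix. -/
noncomputable def rotation (R : Matrix.specialOrthogonalGroup (Fin n) ℝ) : E n ≃ₗᵢ[ℝ] E n :=
  LinearIsometry.toLinearIsometryEquiv
    ⟨Matrix.toEuclideanLin (R : Matrix (Fin n) (Fin n) ℝ),
      norm_toEuclideanLin_specialOrthogonal R⟩ rfl

open scoped Pointwise in
lemma volume_image_of_mem_gammaEps {ε : ℝ} (hε : 0 < ε) {F : E n ≃ᵃ[ℝ] E n}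
    (hF : F ∈ gammaEps 𝒢 ε) (S : Set (E n)) :
    volume (F '' S) = ENNReal.ofReal (ε ^ n) * volume S := by
  obtain ⟨R, -, h, hF⟩ := hF
  have e : F '' S = (fun x => x + h) '' (ε • (rotation R '' S)) := by
    rw [← Set.image_smul, Set.image_image, Set.image_image]
    exact Set.image_congr fun x _ => hF x
  have e2 : volume (rotation R '' S) = volume S := by
    have h3 := (rotation R).symm.measurePreserving.measure_preimage_emb
      (rotation R).symm.toHomeomorph.measurableEmbedding S
    rwa [← LinearIsometryEquiv.image_eq_preimage_symm] at h3
  rw [e, Set.image_add_right, measure_preimage_add_right, Measure.addHaar_smul, e2,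
    finrank_euclideanSpace_fin, abs_of_pos (pow_pos hε n)]

lemma norm_fderiv_comp_le {ε : ℝ} (hε : 0 < ε) {F : E n ≃ᵃ[ℝ] E n}
    (hF : F ∈ gammaEps 𝒢 ε) {w : E n → E m} (hw : Differentiable ℝ w) (x : E n) :
    ‖fderiv ℝ (w ∘ F) x‖ ≤ ε * ‖fderiv ℝ w (F x)‖ := by
  obtain ⟨R, -, h, hF⟩ := hF
  have hF' : ⇑F = fun x => ε • rotation R x + h := funext hF
  have h1 : HasFDerivAt F (ε • ((rotation R).toContinuousLinearEquiv : E n →L[ℝ] E n)) x := by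
    rw [hF']
    exact (((rotation R).toContinuousLinearEquiv : E n →L[ℝ] E n).hasFDerivAt.const_smul
      ε).add_const h
  rw [((hw (F x)).hasFDerivAt.comp x h1).fderiv]
  refine ContinuousLinearMap.opNorm_le_bound _ (by positivity) fun y => ?_
  rw [ContinuousLinearMap.comp_apply]
  refine (ContinuousLinearMap.le_opNorm _ _).trans (le_of_eq ?_)
  rw [_root_.smul_apply, norm_smul, Real.norm_of_nonneg hε.le,
    ContinuousLinearEquiv.coe_coe, LinearIsometryEquiv.coe_toContinuousLinearEquiv,
    LinearIsometryEquiv.norm_map]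
  ring

lemma contDiff_of_mem_gammaEps {ε : ℝ} {F : E n ≃ᵃ[ℝ] E n} (hF : F ∈ gammaEps 𝒢 ε)
    {k : WithTop ℕ∞} : ContDiff ℝ k F := by
  obtain ⟨R, -, h, hF⟩ := hF
  have hF' : ⇑F = fun x => ε • rotation R x + h := funext hF
  rw [hF']
  exact ((rotation R).contDiff.const_smul ε).add contDiff_const

/-! ### The gradient bound -/

lemma integral_smul_fderiv_eq {w : E n → E m} (hw : ContDiff ℝ 1 w) {φ : E n → ℝ}
    (hφ : ContDiff ℝ 1 φ) (hφc : HasCompactSupport φ) :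
    ∫ x, φ x • fderiv ℝ w x = -∫ x, (fderiv ℝ φ x).smulRight (w x) := by
  have hw' : Continuous (fderiv ℝ w) := hw.continuous_fderiv one_ne_zero
  have hφ' : Continuous (fderiv ℝ φ) := hφ.continuous_fderiv one_ne_zero
  have c1 : Continuous fun x => φ x • fderiv ℝ w x := hφ.continuous.smul hw'
  have c2 : Continuous fun x => (fderiv ℝ φ x).smulRight (w x) :=
    isBoundedBilinearMap_smulRight.continuous.comp (hφ'.prodMk hw.continuous)
  have i1 : Integrable fun x => φ x • fderiv ℝ w x :=
    c1.integrable_of_hasCompactSupport (hφc.mono fun x hx hx0 => hx (by ext; simp [hx0]))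
  have i2 : Integrable fun x => (fderiv ℝ φ x).smulRight (w x) := by
    refine c2.integrable_of_hasCompactSupport ((hφc.fderiv ℝ).mono fun x hx hx0 => hx ?_)
    ext y
    simp [hx0]
  ext1 v
  rw [_root_.neg_apply, ContinuousLinearMap.integral_apply i1,
    ContinuousLinearMap.integral_apply i2]
  have h0 : Integrable fun x => φ x • w x :=
    (hφ.continuous.smul hw.continuous).integrable_of_hasCompactSupport hφc.smul_right
  exact integral_smul_fderiv_eq_neg_fderiv_smul_of_integrable (i2.apply_continuousLinearMap v)
    (i1.apply_continuousLinearMap v) h0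
    (fun x _ => (hφ.differentiable one_ne_zero) x) (fun x _ => (hw.differentiable one_ne_zero) x)

lemma memLp_of_continuous_of_isBounded {F : Type*} [NormedAddCommGroup F] {f : E n → F}
    [SecondCountableTopologyEither (E n) F] (hf : Continuous f) (hDb : Bornology.IsBounded D)
    (q : ℝ≥0∞) : MemLp f q (volume.restrict D) := by
  have hK := hDb.isCompact_closure
  have : IsFiniteMeasure ((volume : Measure (E n)).restrict (closure D)) :=
    ⟨by simpa using hK.measure_lt_top⟩
  obtain ⟨C, hC⟩ := hK.exists_bound_of_continuousOn hf.continuousOn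
  have : MemLp f q (volume.restrict (closure D)) := MemLp.of_bound hf.aestronglyMeasurable C
    ((ae_restrict_iff' hK.measurableSet).2 (Eventually.of_forall hC))
  exact this.mono_measure (Measure.restrict_mono subset_closure le_rfl)

lemma isSobolev_of_contDiff {w : E n → E m} (hw : ContDiff ℝ 1 w)
    (hDb : Bornology.IsBounded D) : IsSobolev LinearMap.id p D w (fderiv ℝ w) where
  memLp := memLp_of_continuous_of_isBounded hw.continuous hDb _
  memLp_grad := memLp_of_continuous_of_isBounded (hw.continuous_fderiv one_ne_zero) hDb _
  represents := by
    intro φ hφ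
    have hz : ∀ x ∉ D, φ x = 0 := fun x hx =>
      image_eq_zero_of_notMem_tsupport fun h => hx (hφ.tsupport_subset h)
    have hz' : ∀ x ∉ D, fderiv ℝ φ x = 0 := fun x hx =>
      image_eq_zero_of_notMem_tsupport fun h =>
        hx (hφ.tsupport_subset (tsupport_fderiv_subset ℝ h))
    rw [pairingD, setIntegral_eq_integral_of_forall_compl_eq_zero (fun x hx => by
        rw [hz x hx]; ext; simp),
      setIntegral_eq_integral_of_forall_compl_eq_zero (fun x hx => by
        rw [hz' x hx]; ext; simp)]
    exact integral_smul_fderiv_eq hw (hφ.contDiff.of_le (by simp)) hφ.hasCompactSupport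

lemma self_mem_cells : D ∈ cells (gamma 𝒢 : Set (E n ≃ᵃ[ℝ] E n)) D Set.univ :=
  ⟨1, one_mem _, by ext; simp, Set.subset_univ _⟩

/-- Pulling back to `D` multiplies gradients by at most `ε`, which costs `ε ^ p`, while `S` has
volume `ε ^ n` times that of `D`. The normalization `ε ^ (n - p)` is exactly what makes the bound
independent of the scale. -/
lemma alpha_le_of_norm_fderiv_le (hp : 1 ≤ p) (hα : IsCore p D (gamma 𝒢) α)
    (hDb : Bornology.IsBounded D) :
    ∃ c : ℝ≥0, ∀ (w : E n → E m), ContDiff ℝ 1 w → ∀ (ε η : ℝ), 0 < ε → 0 ≤ η →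
      ∀ S ∈ cells (gammaEps 𝒢 ε) D Set.univ, (∀ x ∈ S, ‖fderiv ℝ w x‖ ≤ η) →
        ENNReal.ofReal (ε ^ ((n : ℝ) - p)) * (α w S : ℝ≥0∞) ≤
          c * ENNReal.ofReal (η ^ p) * volume S := by
  obtain ⟨c, -, hc⟩ := hα.grad_bound
  refine ⟨c, fun w hw ε η hε hη S hS hwS => ?_⟩
  obtain ⟨F, hF, rfl, -⟩ := hS
  have hwF : ContDiff ℝ 1 (w ∘ F) := hw.comp (contDiff_of_mem_gammaEps hF)
  rw [← hα.change_var D self_mem_cells w (memLpLoc_of_continuous hw.continuous) F ⟨ε, hε, hF⟩,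
    volume_image_of_mem_gammaEps hε hF]
  have h1 := hc _ _ (memLpLoc_of_continuous hwF.continuous) (isSobolev_of_contDiff hwF hDb)
  have h2 : ∫⁻ x in D, ‖fderiv ℝ (w ∘ F) x‖ₑ ^ p ≤
      ENNReal.ofReal ((ε * η) ^ p) * volume D := by
    rw [← setLIntegral_const]
    refine setLIntegral_mono measurable_const fun x hx => ?_
    rw [← ENNReal.ofReal_rpow_of_nonneg (by positivity) (by linarith), ← ofReal_norm]
    gcongr
    exact (norm_fderiv_comp_le hε hF (hw.differentiable one_ne_zero) x).trans
      (by gcongr; exact hwS _ ⟨x, hx, rfl⟩)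
  have h3 : ε ^ ((n : ℝ) - p) * (ε * η) ^ p = η ^ p * ε ^ n := by
    rw [Real.rpow_sub hε, Real.rpow_natCast, Real.mul_rpow hε.le hη]
    have := (Real.rpow_pos_of_pos hε p).ne'
    field_simp
  calc _ ≤ ENNReal.ofReal (ε ^ ((n : ℝ) - p)) * (c * (ENNReal.ofReal ((ε * η) ^ p) * volume D)) := by
        gcongr
        exact h1.trans (by gcongr)
    _ = c * (ENNReal.ofReal (ε ^ ((n : ℝ) - p)) * ENNReal.ofReal ((ε * η) ^ p)) * volume D := by
        ring
    _ = _ := by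
        rw [← ENNReal.ofReal_mul (by positivity), h3, ENNReal.ofReal_mul (by positivity)]
        ring

/-- Convexity at the midpoint of `2u` and `2v`, then homogeneity. -/
lemma alpha_add_le (hα : IsCore p D (gamma 𝒢) α) {S : Set (E n)}
    (hS : S ∈ cells (gamma 𝒢 : Set (E n ≃ᵃ[ℝ] E n)) D Set.univ) {u v : E n → E m}
    (hu : MemLpLoc p u) (hv : MemLpLoc p v) : α (u + v) S ≤ 2 ^ p * (α u S + α v S) := by
  have h3 := hα.convex S hS _ _ (hu.const_smul 2) (hv.const_smul 2) 2⁻¹ 2⁻¹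
    (by rw [← two_mul, mul_inv_cancel₀ two_ne_zero])
  have e : ((2⁻¹ : ℝ≥0) • ((2 : ℝ) • u) + (2⁻¹ : ℝ≥0) • ((2 : ℝ) • v)) = u + v := by
    funext x
    simp [NNReal.smul_def, smul_smul]
  have h2 : ‖(2 : ℝ)‖₊ = 2 := by ext; simp
  rw [e, hα.homogeneous S hS u hu, hα.homogeneous S hS v hv, h2] at h3
  have h4 : (2⁻¹ : ℝ≥0) ≤ 1 := inv_le_one_of_one_le₀ one_le_two
  rw [mul_add]
  exact h3.trans (add_le_add (mul_le_of_le_one_left zero_le h4)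
    (mul_le_of_le_one_left zero_le h4))

/-! ### Dilations -/

lemma dil_mem_gammaEps {s : ℝ} (hs : 0 < s) (h : E n) : dil n hs h ∈ gammaEps 𝒢 s :=
  ⟨1, one_mem _, h, fun x => by rw [dil_apply]; simp⟩

lemma continuous_affineEquiv (F : E n ≃ᵃ[ℝ] E n) : Continuous F :=
  F.toAffineMap.continuous_of_finiteDimensional

lemma isOpen_image_affineEquiv (F : E n ≃ᵃ[ℝ] E n) {U : Set (E n)} (hU : IsOpen U) :
    IsOpen (F '' U) := by
  rw [← AffineEquiv.preimage_symm]
  exact hU.preimage (continuous_affineEquiv F.symm)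

lemma measurableEmbedding_affineEquiv (F : E n ≃ᵃ[ℝ] E n) : MeasurableEmbedding F :=
  (Homeomorph.mk F.toEquiv (continuous_affineEquiv F)
    (continuous_affineEquiv F.symm)).measurableEmbedding

lemma isOpen_of_mem_cells {Γ : Set (E n ≃ᵃ[ℝ] E n)} {Ω S : Set (E n)} (hD : IsOpen D)
    (hS : S ∈ cells Γ D Ω) : IsOpen S := by
  obtain ⟨F, -, rfl, -⟩ := hS
  exact isOpen_image_affineEquiv F hD

lemma dil_image_mem_cells {s δ : ℝ} (hs : 0 < s) (h : E n) {S U V : Set (E n)}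
    (hS : S ∈ cells (gammaEps 𝒢 δ) D U) (hV : dil n hs h '' S ⊆ V) :
    dil n hs h '' S ∈ cells (gammaEps 𝒢 (s * δ)) D V := by
  obtain ⟨F, ⟨R, hR, k, hF⟩, rfl, -⟩ := hS
  have himg : (dil n hs h * F) '' D = dil n hs h '' (F '' D) := by
    rw [Set.image_image]
    rfl
  refine ⟨dil n hs h * F, ⟨R, hR, s • k + h, fun x => ?_⟩, himg, himg ▸ hV⟩
  rw [AffineEquiv.mul_def, AffineEquiv.trans_apply, dil_apply, hF, smul_add, smul_smul, add_assoc]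

lemma map_dil_volume {s : ℝ} (hs : 0 < s) (h : E n) :
    Measure.map (dil n hs h) volume = ENNReal.ofReal (s ^ n)⁻¹ • (volume : Measure (E n)) := by
  have e : ⇑(dil n hs h) = (fun x => x + h) ∘ fun x => s • x := funext fun x => dil_apply hs h x
  rw [e, ← Measure.map_map (measurable_add_const h) (measurable_const_smul s),
    Measure.map_addHaar_smul _ hs.ne', Measure.map_smul, map_add_right_eq_self,
    finrank_euclideanSpace_fin, abs_of_pos (by positivity)]

lemma MemLpLoc.comp_dil {u : E n → E m} (hu : MemLpLoc p u) {s : ℝ} (hs : 0 < s) (h : E n) :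
    MemLpLoc p (u ∘ dil n hs h) := by
  intro K hK
  have hF := measurableEmbedding_affineEquiv (dil n hs h)
  rw [← hF.memLp_map_measure_iff]
  have h1 : Measure.map (dil n hs h) (volume.restrict K) =
      ENNReal.ofReal (s ^ n)⁻¹ • volume.restrict (dil n hs h '' K) := by
    rw [← Measure.restrict_smul, ← map_dil_volume hs h, hF.restrict_map,
      Set.preimage_image_eq _ (dil n hs h).injective]
  rw [h1]
  exact (hu _ (hK.image (continuous_affineEquiv _))).smul_measure ENNReal.ofReal_ne_top

/-- The images of the cells form an admissible family in the supremum defining `G` at scale `s * δ`.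
-/
lemma tsum_alpha_dil_le {s δ : ℝ} (hs : 0 < s) (h : E n) {u : E n → E m} {U Ω : Set (E n)}
    {𝓕 : Set (Set (E n))} (h1 : 𝓕 ⊆ cells (gammaEps 𝒢 δ) D U) (h2 : 𝓕.PairwiseDisjoint id)
    (hU : dil n hs h '' U ⊆ Ω) :
    ENNReal.ofReal ((s * δ) ^ ((n : ℝ) - p)) * ∑' S : 𝓕, (α u (dil n hs h '' S) : ℝ≥0∞) ≤
      G p D 𝒢 α (s * δ) u Ω := by
  have hinj : Function.Injective fun S : Set (E n) => dil n hs h '' S :=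
    (dil n hs h).injective.image_injective
  rw [← tsum_image (fun S => (α u S : ℝ≥0∞)) hinj.injOn]
  refine le_G ?_ ?_
  · rintro _ ⟨S, hS, rfl⟩
    refine dil_image_mem_cells hs h (h1 hS) ((Set.image_mono ?_).trans hU)
    obtain ⟨F, -, rfl, hFU⟩ := h1 hS
    exact hFU
  · rintro _ ⟨S, hS, rfl⟩ _ ⟨S', hS', rfl⟩ hne
    exact (Set.disjoint_image_iff (dil n hs h).injective).2
      (h2 hS hS' fun e => hne (by rw [e]))

lemma norm_le_of_mem_Q {x : E n} (hx : x ∈ Q n) : ‖x‖ ≤ n := by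
  have h1 : ‖x‖ ^ 2 ≤ (n : ℝ) ^ 2 := by
    rw [EuclideanSpace.norm_sq_eq]
    calc ∑ i, ‖x i‖ ^ 2 ≤ ∑ _i : Fin n, (1 : ℝ) := by
          refine Finset.sum_le_sum fun i _ => ?_
          obtain ⟨h1, h2⟩ := hx i
          rw [Real.norm_eq_abs, sq_abs]
          nlinarith
      _ = n := by simp
      _ ≤ (n : ℝ) ^ 2 := by exact_mod_cast Nat.le_self_pow two_ne_zero n
  exact (sq_le_sq₀ (norm_nonneg _) (Nat.cast_nonneg _)).1 h1

lemma volume_Q_ne_top : volume (Q n) ≠ ⊤ :=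
  ((Metric.isBounded_closedBall (x := (0 : E n)) (r := n)).subset fun x hx => by
    simpa using norm_le_of_mem_Q hx).measure_lt_top.ne

/-- The cellwise bound is proportional to volume, and disjoint cells inside `sQ` have total volume
at most `s ^ n` times that of `Q`. The result does not depend on the cell scale `δ`. -/
lemma tsum_alpha_le_of_norm_fderiv_le (hp : 1 ≤ p) (hα : IsCore p D (gamma 𝒢) α) (hD : IsOpen D)
    (hDb : Bornology.IsBounded D) :
    ∃ c : ℝ≥0, ∀ (w : E n → E m), ContDiff ℝ 1 w → ∀ (δ s η : ℝ) (_ : 0 < δ) (hs : 0 < s),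
      0 ≤ η → (∀ x ∈ dil n hs 0 '' Q n, ‖fderiv ℝ w x‖ ≤ η) → ∀ 𝓕 : Set (Set (E n)),
        𝓕 ⊆ cells (gammaEps 𝒢 δ) D (Q n) → 𝓕.PairwiseDisjoint id →
          ENNReal.ofReal ((s * δ) ^ ((n : ℝ) - p)) * ∑' S : 𝓕, (α w (dil n hs 0 '' S) : ℝ≥0∞) ≤
            ENNReal.ofReal (s ^ n) * (c * ENNReal.ofReal (η ^ p) * volume (Q n)) := by
  obtain ⟨c, hc⟩ := alpha_le_of_norm_fderiv_le hp hα hDb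
  refine ⟨c, fun w hw δ s η hδ hs hη hwη 𝓕 h1 h2 => ?_⟩
  have hsub : ∀ S ∈ 𝓕, dil n hs 0 '' S ⊆ dil n hs 0 '' Q n := by
    intro S hS
    obtain ⟨F, -, rfl, hFU⟩ := h1 hS
    exact Set.image_mono hFU
  have hvol : ∑' S : 𝓕, volume (dil n hs 0 '' (S : Set (E n))) ≤
      ENNReal.ofReal (s ^ n) * volume (Q n) := by
    rw [← volume_image_of_mem_gammaEps (𝒢 := 𝒢) hs (dil_mem_gammaEps hs 0)]
    refine (tsum_meas_le_meas_iUnion_of_disjoint volume (fun S : 𝓕 =>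
      (isOpen_image_affineEquiv _ (isOpen_of_mem_cells hD (h1 S.2))).measurableSet) ?_).trans
      (measure_mono (Set.iUnion_subset fun S => hsub S S.2))
    intro S S' hne
    exact (Set.disjoint_image_iff (dil n hs 0).injective).2
      (h2 S.2 S'.2 fun e => hne (Subtype.ext e))
  rw [← ENNReal.tsum_mul_left]
  calc _ ≤ ∑' S : 𝓕, c * ENNReal.ofReal (η ^ p) * volume (dil n hs 0 '' (S : Set (E n))) :=
        ENNReal.tsum_le_tsum fun S => hc w hw _ η (mul_pos hs hδ) hη _
          (dil_image_mem_cells hs 0 (h1 S.2) (Set.subset_univ _))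
          fun x hx => hwη x (hsub S S.2 hx)
    _ ≤ c * ENNReal.ofReal (η ^ p) * (ENNReal.ofReal (s ^ n) * volume (Q n)) := by
        rw [ENNReal.tsum_mul_left]
        gcongr
    _ = _ := by ring

/-! ### Comparing a `C¹` function with its linear part on a small cube -/

/-- A linear map on `Q` looks the same as on `sQ` up to the factor `s ^ p`. Moving to `sQ` allows
the splitting `A = v + (A - v)`; the factor `s ^ n` assumed for the second part cancels the change
of scale. -/
lemma G_clm_le (hα : IsCore p D (gamma 𝒢) α) (A : Mat m n) {v : E n → E m} (hv : MemLpLoc p v)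
    {s δ : ℝ} (hs : 0 < s) (hδ : 0 < δ) {a b : ℝ≥0∞}
    (hva : ∀ 𝓕 : Set (Set (E n)), 𝓕 ⊆ cells (gammaEps 𝒢 δ) D (Q n) → 𝓕.PairwiseDisjoint id →
      ENNReal.ofReal ((s * δ) ^ ((n : ℝ) - p)) * ∑' S : 𝓕, (α v (dil n hs 0 '' S) : ℝ≥0∞) ≤ a)
    (hvb : ∀ 𝓕 : Set (Set (E n)), 𝓕 ⊆ cells (gammaEps 𝒢 δ) D (Q n) → 𝓕.PairwiseDisjoint id →
      ENNReal.ofReal ((s * δ) ^ ((n : ℝ) - p)) *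
        ∑' S : 𝓕, (α (⇑A - v) (dil n hs 0 '' S) : ℝ≥0∞) ≤ ENNReal.ofReal (s ^ n) * b) :
    G p D 𝒢 α δ (⇑A) (Q n) ≤
      ENNReal.ofReal (s ^ n)⁻¹ * (2 ^ p : ℝ≥0) * a + (2 ^ p : ℝ≥0) * b := by
  rw [← one_mul (G _ _ _ _ _ _ _)]
  refine G_le fun 𝓕 h1 h2 => ?_
  rw [one_mul]
  have hcell : ∀ S : 𝓕, (S : Set (E n)) ∈ cells (gamma 𝒢 : Set (E n ≃ᵃ[ℝ] E n)) D Set.univ :=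
    fun S => cells_gammaEps_subset hδ _ (h1 S.2)
  have hcell' : ∀ S : 𝓕, dil n hs 0 '' (S : Set (E n)) ∈
      cells (gamma 𝒢 : Set (E n ≃ᵃ[ℝ] E n)) D Set.univ := fun S =>
    cells_gammaEps_subset (mul_pos hs hδ) Set.univ
      (dil_image_mem_cells hs 0 (h1 S.2) (Set.subset_univ _))
  have hS : ∀ S : 𝓕, (α (⇑A) S : ℝ≥0∞) ≤ ENNReal.ofReal (s ^ p)⁻¹ * ((2 ^ p : ℝ≥0) *
      ((α v (dil n hs 0 '' S) : ℝ≥0∞) + (α (⇑A - v) (dil n hs 0 '' S) : ℝ≥0∞))) := by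
    intro S
    have h3 := alpha_dil hα A hs 0 (hcell S)
    have h4 := alpha_add_le hα (hcell' S) hv
      ((memLpLoc_clm A).add (hv.const_smul (-1)))
    rw [neg_one_smul, ← sub_eq_add_neg, add_sub_cancel, h3] at h4
    have h5 : ENNReal.ofReal (s ^ p)⁻¹ * ((‖s‖₊ ^ p : ℝ≥0) : ℝ≥0∞) = 1 := by
      have : ((‖s‖₊ ^ p : ℝ≥0) : ℝ≥0∞) = ENNReal.ofReal (s ^ p) := by
        rw [ENNReal.ofReal, ENNReal.coe_inj]
        ext
        rw [Real.coe_toNNReal _ (Real.rpow_nonneg hs.le _), NNReal.coe_rpow, coe_nnnorm,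
          Real.norm_of_nonneg hs.le]
      rw [this, ← ENNReal.ofReal_mul (by positivity),
        inv_mul_cancel₀ (Real.rpow_pos_of_pos hs p).ne', ENNReal.ofReal_one]
    calc (α (⇑A) S : ℝ≥0∞)
        = ENNReal.ofReal (s ^ p)⁻¹ * ((‖s‖₊ ^ p * α (⇑A) S : ℝ≥0) : ℝ≥0∞) := by
          rw [ENNReal.coe_mul, ← mul_assoc, h5, one_mul]
      _ ≤ _ := by
          gcongr
          exact_mod_cast h4
  have hscale : ENNReal.ofReal (δ ^ ((n : ℝ) - p)) * ENNReal.ofReal (s ^ p)⁻¹ =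
      ENNReal.ofReal (s ^ n)⁻¹ * ENNReal.ofReal ((s * δ) ^ ((n : ℝ) - p)) := by
    rw [← ENNReal.ofReal_mul (by positivity), ← ENNReal.ofReal_mul (by positivity)]
    congr 1
    rw [Real.mul_rpow hs.le hδ.le, Real.rpow_sub hs, Real.rpow_natCast]
    have := (Real.rpow_pos_of_pos hs p).ne'
    field_simp
  have hone : ENNReal.ofReal (s ^ n)⁻¹ * ENNReal.ofReal (s ^ n) = 1 := by
    rw [← ENNReal.ofReal_mul (by positivity), inv_mul_cancel₀ (by positivity), ENNReal.ofReal_one]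
  calc ENNReal.ofReal (δ ^ ((n : ℝ) - p)) * ∑' S : 𝓕, (α (⇑A) S : ℝ≥0∞)
      ≤ ENNReal.ofReal (δ ^ ((n : ℝ) - p)) * ∑' S : 𝓕, ENNReal.ofReal (s ^ p)⁻¹ * ((2 ^ p : ℝ≥0) *
      ((α v (dil n hs 0 '' S) : ℝ≥0∞) + (α (⇑A - v) (dil n hs 0 '' S) : ℝ≥0∞))) := by
        gcongr with S
        exact hS S
    _ = ENNReal.ofReal (s ^ n)⁻¹ * (2 ^ p : ℝ≥0) *
          (ENNReal.ofReal ((s * δ) ^ ((n : ℝ) - p)) *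
            ∑' S : 𝓕, (α v (dil n hs 0 '' S) : ℝ≥0∞)) +
        ENNReal.ofReal (s ^ n)⁻¹ * (2 ^ p : ℝ≥0) *
          (ENNReal.ofReal ((s * δ) ^ ((n : ℝ) - p)) *
            ∑' S : 𝓕, (α (⇑A - v) (dil n hs 0 '' S) : ℝ≥0∞)) := by
        rw [ENNReal.tsum_mul_left, ENNReal.tsum_mul_left, ENNReal.tsum_add, ← mul_assoc, hscale]
        ring
    _ ≤ ENNReal.ofReal (s ^ n)⁻¹ * (2 ^ p : ℝ≥0) * a +
        ENNReal.ofReal (s ^ n)⁻¹ * (2 ^ p : ℝ≥0) * (ENNReal.ofReal (s ^ n) * b) :=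
        add_le_add (mul_le_mul' le_rfl (hva 𝓕 h1 h2)) (mul_le_mul' le_rfl (hvb 𝓕 h1 h2))
    _ = _ := by
        congr 1
        rw [mul_assoc, mul_left_comm _ _ b, mul_left_comm, ← mul_assoc, ← mul_assoc, mul_comm _
          (ENNReal.ofReal (s ^ n)⁻¹), hone, one_mul]

lemma frequently_mul_lt_of_liminf_eq_zero {f : ℝ → ℝ≥0∞} (hf : liminf f (𝓝[>] (0 : ℝ)) = 0)
    {s : ℝ} (hs : 0 < s) {a : ℝ≥0∞} (ha : a ≠ ⊤) {κ : ℝ≥0∞} (hκ : 0 < κ) :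
    ∃ᶠ δ in 𝓝[>] (0 : ℝ), a * f (s * δ) < κ := by
  have h1 : liminf (fun ε => a * f ε) (𝓝[>] (0 : ℝ)) < κ := by
    rw [ENNReal.liminf_const_mul_of_ne_top ha, hf, mul_zero]
    exact hκ
  have h2 := frequently_lt_of_liminf_lt (by isBoundedDefault) h1
  have h3 : Tendsto (fun ε : ℝ => s⁻¹ * ε) (𝓝[>] 0) (𝓝[>] 0) := by
    refine tendsto_nhdsWithin_iff.2 ⟨?_, ?_⟩
    · have : Tendsto (fun ε : ℝ => s⁻¹ * ε) (𝓝 0) (𝓝 (s⁻¹ * 0)) :=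
        (continuous_const_mul s⁻¹).tendsto 0
      rw [mul_zero] at this
      exact this.mono_left nhdsWithin_le_nhds
    · filter_upwards [self_mem_nhdsWithin] with ε hε
      exact mul_pos (inv_pos.2 hs) hε
  refine h3.frequently (h2.mono fun ε hε => ?_)
  rwa [mul_inv_cancel_left₀ hs.ne']

/-- If the oscillation of `u` on `Ω` vanishes in the limit, the gradients of the mollifications of
`u` are null matrices of `ψ`. -/
theorem psi_fderiv_convolution_eq_zero (hp : 1 ≤ p) {Ω : Set (E n)} (hD : IsOpen D)
    (hDb : Bornology.IsBounded D) (hα : IsCore p D (gamma 𝒢) α)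
    (hlsc : IsLpLsc hp D (gamma 𝒢) α) {u : E n → E m} (hu : MemLpLoc p u)
    (hG : Gminus p D 𝒢 α u Ω = 0) {f : E n → E m} (hf : MemLp f (ENNReal.ofReal p) volume)
    (hf1 : Integrable f) {ρ : E n → ℝ} (hρ : ContDiff ℝ 1 ρ) (hρc : HasCompactSupport ρ)
    {r : ℝ} (hr : 0 < r) (hΩ : ∀ t ∈ tsupport ρ, ∀ x ∈ Metric.ball (0 : E n) r, x - t ∈ Ω)
    (hfu : ∀ t ∈ tsupport ρ, ∀ x ∈ Metric.ball (0 : E n) r, f (x - t) = u (x - t)) :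
    psi p D 𝒢 α (fderiv ℝ (convolution ρ f (ContinuousLinearMap.lsmul ℝ ℝ) volume) 0) = 0 := by
  set v : E n → E m := convolution ρ f (ContinuousLinearMap.lsmul ℝ ℝ) volume with hvdef
  have hv : ContDiff ℝ 1 v := hρc.contDiff_convolution_left _ hρ hf1.locallyIntegrable
  set A : Mat m n := fderiv ℝ v 0 with hA
  obtain ⟨C, hC⟩ := tsum_alpha_convolution_le hα hlsc hρ.continuous hρc
  obtain ⟨c, hc⟩ := tsum_alpha_le_of_norm_fderiv_le hp hα hD hDb
  set K : ℝ≥0∞ := (2 ^ p : ℝ≥0) * (c * volume (Q n)) with hK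
  have hKt : K ≠ ⊤ := by
    have := volume_Q_ne_top (n := n)
    finiteness
  have key : ∀ η : ℝ, 0 < η → psi p D 𝒢 α A ≤ K * ENNReal.ofReal (η ^ p) := by
    intro η hη
    obtain ⟨r', hr', hball⟩ := Metric.continuousAt_iff.1
      (hv.continuous_fderiv one_ne_zero).continuousAt η hη
    -- Points of `Q` have norm at most `n`, so this puts `sQ` strictly inside both balls: the one
    -- where `f` agrees with `u` after translation, and the one where the gradient of `v` is
    -- `η`-close to `A`.
    set s : ℝ := min r r' / (n + 1) with hsdef
    have hn : (0 : ℝ) < n + 1 := by positivity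
    have hs : 0 < s := div_pos (lt_min hr hr') hn
    have hsQ : ∀ x ∈ dil n hs 0 '' Q n, ‖x‖ < min r r' := by
      rintro _ ⟨x, hx, rfl⟩
      rw [dil_apply, add_zero, norm_smul, Real.norm_of_nonneg hs.le]
      calc s * ‖x‖ ≤ s * n := by gcongr; exact norm_le_of_mem_Q hx
        _ < s * (n + 1) := by gcongr; linarith
        _ = min r r' := div_mul_cancel₀ _ hn.ne'
    have hbound : ∀ δ : ℝ, 0 < δ → G p D 𝒢 α δ (⇑A) (Q n) ≤
        (ENNReal.ofReal (s ^ n)⁻¹ * (2 ^ p : ℝ≥0) * C) * G p D 𝒢 α (s * δ) u Ω +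
          K * ENNReal.ofReal (η ^ p) := by
      intro δ hδ
      refine (G_clm_le hα A (memLpLoc_of_continuous hv.continuous) hs hδ
        (a := C * G p D 𝒢 α (s * δ) u Ω)
        (b := c * ENNReal.ofReal (η ^ p) * volume (Q n)) ?_ ?_).trans (le_of_eq ?_)
      · intro 𝓕 h1 h2
        set g := ENNReal.ofReal ((s * δ) ^ ((n : ℝ) - p)) with hg
        have hg0 : g ≠ 0 := (ENNReal.ofReal_pos.2 (Real.rpow_pos_of_pos (mul_pos hs hδ) _)).ne'
        have hgt : g ≠ ⊤ := ENNReal.ofReal_ne_top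
        have hcell : ∀ S : 𝓕, dil n hs 0 '' (S : Set (E n)) ∈
            cells (gamma 𝒢 : Set (E n ≃ᵃ[ℝ] E n)) D Set.univ := fun S =>
          cells_gammaEps_subset (mul_pos hs hδ) Set.univ
            (dil_image_mem_cells hs 0 (h1 S.2) (Set.subset_univ _))
        have hsub : ∀ S : 𝓕, dil n hs 0 '' (S : Set (E n)) ⊆ dil n hs 0 '' Q n := by
          rintro ⟨S, hS⟩
          obtain ⟨F, -, rfl, hFU⟩ := h1 hS
          exact Set.image_mono hFU
        -- Shifting by `-t` turns the translate of `f` on a cell of `sQ` into `u` on a cell of `Ω`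
        -- of the same size, so every translate is controlled by the same `G`.
        have hM : ∀ t ∈ tsupport ρ,
            ∑' S : 𝓕, (α (fun x => f (x - t)) (dil n hs 0 '' S) : ℝ≥0∞) ≤
              g⁻¹ * G p D 𝒢 α (s * δ) u Ω := by
          intro t ht
          have hcomp : ∀ x, dil n one_pos (-t) x = x - t := fun x => by
            rw [dil_apply, one_smul, sub_eq_add_neg]
          have hdd : ∀ S : Set (E n),
              dil n one_pos (-t) '' (dil n hs 0 '' S) = dil n hs (-t) '' S := by
            intro S
            rw [Set.image_image]
            refine Set.image_congr fun x _ => ?_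
            rw [hcomp, dil_apply, dil_apply, add_zero, sub_eq_add_neg]
          have he : ∀ S : 𝓕, α (fun x => f (x - t)) (dil n hs 0 '' S) =
              α u (dil n hs (-t) '' S) := by
            intro S
            rw [← hdd, ← hα.change_var _ (hcell S) u hu _ (dil_mem one_pos (-t))]
            refine hα.ext_indep _ (hcell S) _ _ (memLpLoc_of_memLp
              (hf.comp_measurePreserving (measurePreserving_sub_right volume t)))
              (hu.comp_dil one_pos (-t)) ?_
            refine ae_restrict_of_forall_mem (isOpen_of_mem_cells hD (hcell S)).measurableSet
              fun x hx => ?_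
            rw [Function.comp_apply, hcomp]
            refine hfu t ht x ?_
            rw [mem_ball_zero_iff]
            exact (hsQ x (hsub S hx)).trans_le (min_le_left _ _)
          simp_rw [he]
          rw [← ENNReal.mul_le_iff_le_inv hg0 hgt]
          refine tsum_alpha_dil_le hs (-t) h1 h2 ?_
          rw [← hdd]
          rintro _ ⟨x, hx, rfl⟩
          rw [hcomp]
          refine hΩ t ht x ?_
          rw [mem_ball_zero_iff]
          exact (hsQ x hx).trans_le (min_le_left _ _)
        calc g * ∑' S : 𝓕, (α v (dil n hs 0 '' S) : ℝ≥0∞)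
            ≤ g * (C * (g⁻¹ * G p D 𝒢 α (s * δ) u Ω)) := by
              gcongr
              exact hC f hf hf1 𝓕 _ hcell _ hM
          _ = (g * g⁻¹) * (C * G p D 𝒢 α (s * δ) u Ω) := by ring
          _ = _ := by rw [ENNReal.mul_inv_cancel hg0 hgt, one_mul]
      · intro 𝓕 h1 h2
        refine hc (⇑A - v) (A.contDiff.sub hv) δ s η hδ hs hη.le (fun x hx => ?_) 𝓕 h1 h2
        have hx' : dist x 0 < r' := by
          rw [dist_zero_right]
          exact (hsQ x hx).trans_le (min_le_right _ _)
        rw [fderiv_sub A.differentiableAt (hv.differentiable one_ne_zero x),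
          ContinuousLinearMap.fderiv, ← dist_eq_norm, dist_comm]
        exact (hball hx').le
      · rw [hK]
        ring
    refine ENNReal.le_of_forall_pos_le_add fun κ hκ _ => ?_
    -- A vanishing liminf makes `G` small only at frequently many scales. This suffices because the
    -- limit defining `psi` is already known to exist.
    refine le_of_tendsto_of_frequently (tendsto_psi hα hp A) ?_
    have hfin : ENNReal.ofReal (s ^ n)⁻¹ * (2 ^ p : ℝ≥0) * C ≠ ⊤ := by finiteness
    refine ((frequently_mul_lt_of_liminf_eq_zero hG hs hfin (ENNReal.coe_pos.2 hκ)).and_eventually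
      self_mem_nhdsWithin).mono fun δ hδ => ?_
    rw [add_comm]
    exact (hbound δ hδ.2).trans (by gcongr; exact hδ.1.le)
  have hlim : Tendsto (fun η : ℝ => K * ENNReal.ofReal (η ^ p)) (𝓝[>] 0) (𝓝 0) := by
    have h1 : Tendsto (fun η : ℝ => η ^ p) (𝓝[>] 0) (𝓝 0) := by
      have := (Real.continuous_rpow_const (by linarith : 0 ≤ p)).tendsto 0
      rw [Real.zero_rpow (by linarith)] at this
      exact this.mono_left nhdsWithin_le_nhds
    have h2 := ENNReal.Tendsto.const_mul (ENNReal.tendsto_ofReal h1) (Or.inr hKt)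
    rwa [ENNReal.ofReal_zero, mul_zero] at h2
  refine le_antisymm (ge_of_tendsto hlim ?_) zero_le
  filter_upwards [self_mem_nhdsWithin] with η hη
  exact key η hη

/-! ### The distributional gradient and convolutions -/

lemma MemLpLoc.memLp_indicator {u : E n → E m} (hu : MemLpLoc p u) {K : Set (E n)}
    (hK : IsCompact K) : MemLp (K.indicator u) (ENNReal.ofReal p) volume :=
  (memLp_indicator_iff_restrict hK.measurableSet).2 (hu K hK)

lemma MemLpLoc.integrable_indicator (hp : 1 ≤ p) {u : E n → E m} (hu : MemLpLoc p u)
    {K : Set (E n)} (hK : IsCompact K) : Integrable (K.indicator u) := by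
  have : IsFiniteMeasure ((volume : Measure (E n)).restrict K) :=
    ⟨by simpa using hK.measure_lt_top⟩
  rw [integrable_indicator_iff hK.measurableSet]
  exact (hu K hK).integrable (ENNReal.one_le_ofReal.2 hp)

lemma integrable_smulRight {k : E n → E n →L[ℝ] ℝ} (hk : Continuous k)
    (hkc : HasCompactSupport k) {f : E n → E m} (hf : Integrable f) :
    Integrable fun x => (k x).smulRight (f x) := by
  obtain ⟨B, hB⟩ := hk.bounded_above_of_compact_support hkc
  refine (hf.norm.const_mul B).mono'
    (isBoundedBilinearMap_smulRight.continuous.comp_aestronglyMeasurable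
      (hk.aestronglyMeasurable.prodMk hf.aestronglyMeasurable)) (Eventually.of_forall fun x => ?_)
  rw [ContinuousLinearMap.norm_smulRight_apply]
  gcongr
  exact hB x

lemma fderiv_smulRight_congr {φ : E n → ℝ} {u f : E n → E m} (hfu : ∀ y ∈ tsupport φ, f y = u y)
    (y : E n) : (fderiv ℝ φ y).smulRight (u y) = (fderiv ℝ φ y).smulRight (f y) := by
  by_cases hy : y ∈ tsupport φ
  · rw [hfu y hy]
  · have : fderiv ℝ φ y = 0 :=
      image_eq_zero_of_notMem_tsupport fun h => hy (tsupport_fderiv_subset ℝ h)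
    rw [this]
    ext
    simp

lemma IsTestFunction.fderiv_eq_zero {Ω : Set (E n)} {φ : E n → ℝ} (hφ : IsTestFunction Ω φ)
    {y : E n} (hy : y ∉ Ω) : fderiv ℝ φ y = 0 :=
  image_eq_zero_of_notMem_tsupport fun h =>
    hy (hφ.tsupport_subset (tsupport_fderiv_subset ℝ h))

lemma pairingD_eq {L : Mat m n →ₗ[ℝ] Mat m n} {Ω : Set (E n)} {φ : E n → ℝ}
    (hφ : IsTestFunction Ω φ) (u : E n → E m) :
    pairingD L Ω u φ = -∫ y, L ((fderiv ℝ φ y).smulRight (u y)) := by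
  rw [pairingD, setIntegral_eq_integral_of_forall_compl_eq_zero fun x hx => ?_]
  rw [hφ.fderiv_eq_zero hx, ← map_zero L]
  congr 1
  ext
  simp

lemma pairingD_eq_of_eqOn {L : Mat m n →ₗ[ℝ] Mat m n} {Ω : Set (E n)} {φ : E n → ℝ}
    (hφ : IsTestFunction Ω φ) {u f : E n → E m} (hf : Integrable f)
    (hfu : ∀ y ∈ tsupport φ, f y = u y) :
    pairingD L Ω u φ = L (-∫ y, (fderiv ℝ φ y).smulRight (f y)) := by
  have hi := integrable_smulRight (hφ.contDiff.continuous_fderiv (by simp))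
    (hφ.hasCompactSupport.fderiv ℝ) hf
  rw [pairingD_eq hφ, map_neg]
  congr 1
  simp_rw [fderiv_smulRight_congr hfu]
  exact ContinuousLinearMap.integral_comp_comm (LinearMap.toContinuousLinearMap L) hi

/-- The derivative falls on the kernel. The minus sign comes from differentiating `ρ (x - y)` in `y`
instead of `x`, so the gradient of a convolution is a distributional pairing. -/
lemma fderiv_convolution_eq {ρ : E n → ℝ} (hρ : ContDiff ℝ 1 ρ) (hρc : HasCompactSupport ρ)
    {f : E n → E m} (hf : Integrable f) (x : E n) :
    fderiv ℝ (convolution ρ f (ContinuousLinearMap.lsmul ℝ ℝ) volume) x =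
      -∫ y, (fderiv ℝ (fun y => ρ (x - y)) y).smulRight (f y) := by
  rw [(hρc.hasFDerivAt_convolution_left (ContinuousLinearMap.lsmul ℝ ℝ) hρ
    hf.locallyIntegrable x).fderiv, convolution, ← integral_neg,
    ← integral_sub_left_eq_self _ volume x]
  refine integral_congr_ae (Eventually.of_forall fun y => ?_)
  have h1 : fderiv ℝ (fun y => ρ (x - y)) y = -fderiv ℝ ρ (x - y) := by
    have h2 : HasFDerivAt (fun z : E n => x - z) (-ContinuousLinearMap.id ℝ (E n)) y :=
      (hasFDerivAt_id _).const_sub x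
    have h3 := ((hρ.differentiable one_ne_zero (x - y)).hasFDerivAt.comp y h2).fderiv
    rw [Function.comp_def] at h3
    rw [h3]
    ext
    simp
  simp only [h1]
  ext z
  simp [ContinuousLinearMap.precompL_apply]

lemma tsupport_comp_sub_left (ρ : E n → ℝ) (x : E n) :
    tsupport (fun y => ρ (x - y)) = (fun y => x - y) ⁻¹' tsupport ρ :=
  tsupport_comp_eq_preimage ρ (Homeomorph.subLeft x)

lemma hasCompactSupport_comp_sub_left {ρ : E n → ℝ} (hρ : HasCompactSupport ρ) (x : E n) :
    HasCompactSupport fun y => ρ (x - y) :=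
  hρ.comp_homeomorph (Homeomorph.subLeft x)

/-! ### Vanishing of the distributional gradient modulo the null space -/

theorem psi_pairingD_eq_zero (hp : 1 ≤ p) {Ω : Set (E n)} (hΩ : IsOpen Ω) (hD : IsOpen D)
    (hDb : Bornology.IsBounded D) (hα : IsCore p D (gamma 𝒢) α)
    (hlsc : IsLpLsc hp D (gamma 𝒢) α) {u : E n → E m} (hu : MemLpLoc p u)
    (hG : Gminus p D 𝒢 α u Ω = 0) {φ : E n → ℝ} (hφ : IsTestFunction Ω φ) :
    psi p D 𝒢 α (pairingD LinearMap.id Ω u φ) = 0 := by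
  -- The margin `r` around the support leaves room for the small cube: all its translates by points
  -- of the reflected support stay in `Ω`.
  obtain ⟨r, hr, hrΩ⟩ :=
    hφ.hasCompactSupport.isCompact.exists_thickening_subset_open hΩ hφ.tsupport_subset
  obtain ⟨R, hR⟩ := (hφ.hasCompactSupport.isCompact.isBounded.thickening
    (δ := r)).subset_closedBall (0 : E n)
  have hK := isCompact_closedBall (0 : E n) R
  set f : E n → E m := (Metric.closedBall (0 : E n) R).indicator u
  have hf1 : Integrable f := hu.integrable_indicator hp hK
  have hfu : ∀ y ∈ Metric.thickening r (tsupport φ), f y = u y := fun y hy =>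
    Set.indicator_of_mem (hR hy) u
  have hneg : (fun y => φ (0 - (0 - y))) = φ := by
    funext y
    rw [sub_sub_cancel]
  have hρ : ContDiff ℝ 1 fun y => φ (0 - y) :=
    (hφ.contDiff.of_le (by simp)).comp (contDiff_const.sub contDiff_id)
  have hρc : HasCompactSupport fun y => φ (0 - y) :=
    hasCompactSupport_comp_sub_left hφ.hasCompactSupport 0
  have hmem : ∀ t ∈ tsupport (fun y => φ (0 - y)), ∀ x ∈ Metric.ball (0 : E n) r,
      x - t ∈ Metric.thickening r (tsupport φ) := by
    intro t ht x hx
    rw [tsupport_comp_sub_left] at ht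
    refine Metric.mem_thickening_iff.2 ⟨0 - t, ht, ?_⟩
    rw [dist_sub_right]
    exact hx
  have h1 := psi_fderiv_convolution_eq_zero hp hD hDb hα hlsc hu hG (hu.memLp_indicator hK) hf1
    hρ hρc hr (fun t ht x hx => hrΩ (hmem t ht x hx)) (fun t ht x hx => hfu _ (hmem t ht x hx))
  rw [fderiv_convolution_eq hρ hρc hf1, hneg] at h1
  rwa [pairingD_eq_of_eqOn hφ hf1 fun y hy => hfu y (Metric.self_subset_thickening hr _ hy)]

/-- A linear map on a finite-dimensional space is continuous, so it commutes with the integral. -/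
lemma pairingD_eq_map_pairingD_id (hp : 1 ≤ p) {Ω : Set (E n)} {u : E n → E m}
    (hu : MemLpLoc p u) {φ : E n → ℝ} (hφ : IsTestFunction Ω φ) (L : Mat m n →ₗ[ℝ] Mat m n) :
    pairingD L Ω u φ = L (pairingD LinearMap.id Ω u φ) := by
  have hf := hu.integrable_indicator hp hφ.hasCompactSupport.isCompact
  have hfu : ∀ y ∈ tsupport φ, (tsupport φ).indicator u y = u y := fun y hy =>
    Set.indicator_of_mem hy u
  rw [pairingD_eq_of_eqOn hφ hf hfu, pairingD_eq_of_eqOn hφ hf hfu, LinearMap.id_apply]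

theorem dEqZero_of_forall_psi_eq_zero (hp : 1 ≤ p) {Ω : Set (E n)} (hΩ : IsOpen Ω)
    (hD : IsOpen D) (hDb : Bornology.IsBounded D) (hα : IsCore p D (gamma 𝒢) α)
    (hlsc : IsLpLsc hp D (gamma 𝒢) α) {u : E n → E m} (hu : MemLpLoc p u)
    (hG : Gminus p D 𝒢 α u Ω = 0) {L : Mat m n →ₗ[ℝ] Mat m n}
    (hL : ∀ A, psi p D 𝒢 α A = 0 → L A = 0) : DEqZero L Ω u := by
  intro φ hφ
  rw [pairingD_eq_map_pairingD_id hp hu hφ]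
  exact hL _ (psi_pairingD_eq_zero hp hΩ hD hDb hα hlsc hu hG hφ)

/-! ### Functions with vanishing distributional gradient -/

/-- Mollifications of `u` have zero gradient on a smaller ball, hence are constant there, and they
converge a.e. to `u`. -/
lemma exists_ae_eq_const_ball (hp : 1 ≤ p) {Ω : Set (E n)} (hΩ : IsOpen Ω) {u : E n → E m}
    (hu : MemLpLoc p u) (h : DEqZero LinearMap.id Ω u) {x₀ : E n} (hx₀ : x₀ ∈ Ω) :
    ∃ r > 0, ∃ c : E m, ∀ᵐ x ∂volume.restrict (Metric.ball x₀ r), u x = c := by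
  obtain ⟨R, hR, hRΩ⟩ := Metric.isOpen_iff.1 hΩ x₀ hx₀
  -- Half the radius: kernels supported within distance `r` of a point of the smaller ball stay
  -- inside the ball of radius `R`.
  set r := R / 2 with hr_def
  have hr : 0 < r := half_pos hR
  refine ⟨r, hr, ?_⟩
  have hK := isCompact_closedBall x₀ R
  set f : E n → E m := (Metric.closedBall x₀ R).indicator u
  have hf1 : Integrable f := hu.integrable_indicator hp hK
  -- The ratio of outer to inner radius is fixed at `2`, as the a.e. convergence of mollifications
  -- requires a bounded ratio.
  let φ : ℕ → ContDiffBump (0 : E n) := fun k =>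
    { rIn := r / (k + 1) / 2
      rOut := r / (k + 1)
      rIn_pos := by positivity
      rIn_lt_rOut := half_lt_self (by positivity) }
  have hrOut : Tendsto (fun k => (φ k).rOut) atTop (𝓝 0) := by
    have := (tendsto_one_div_add_atTop_nhds_zero_nat (𝕜 := ℝ)).const_mul r
    rw [mul_zero] at this
    exact this.congr fun k => by rw [mul_one_div]
  have hconv := ContDiffBump.ae_convolution_tendsto_right_of_locallyIntegrable (μ := volume)
    (K := 2) hrOut (Eventually.of_forall fun k => by
      change r / (k + 1) ≤ 2 * (r / (k + 1) / 2)
      linarith) hf1.locallyIntegrable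
  let v : ℕ → E n → E m := fun k =>
    convolution ((φ k).normed volume) f (ContinuousLinearMap.lsmul ℝ ℝ) volume
  have hρ : ∀ k, ContDiff ℝ ∞ ((φ k).normed volume) := fun k => (φ k).contDiff_normed
  have hρc : ∀ k, HasCompactSupport ((φ k).normed volume) := fun k =>
    (φ k).hasCompactSupport_normed
  have hconst : ∀ k, ∃ c, ∀ x ∈ Metric.ball x₀ r, v k x = c := by
    intro k
    have hvk : ContDiff ℝ 1 (v k) :=
      (hρc k).contDiff_convolution_left _ ((hρ k).of_le (by simp)) hf1.locallyIntegrable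
    refine Metric.isOpen_ball.exists_is_const_of_fderiv_eq_zero (𝕜 := ℝ)
      (convex_ball x₀ r).isPreconnected (hvk.differentiable one_ne_zero).differentiableOn
      fun x hx => ?_
    have hsub : tsupport (fun y => (φ k).normed volume (x - y)) ⊆ Metric.ball x₀ R := by
      rw [tsupport_comp_sub_left, (φ k).tsupport_normed_eq]
      intro y hy
      have h1 : dist x y ≤ r / (k + 1) := by
        rw [dist_eq_norm]
        simpa using hy
      have h2 : r / ((k : ℝ) + 1) ≤ r := div_le_self hr.le (by linarith [Nat.cast_nonneg (α := ℝ) k])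
      have h3 : dist x x₀ < r := hx
      rw [Metric.mem_ball]
      linarith [dist_triangle y x x₀, dist_comm x y]
    have htest : IsTestFunction Ω (fun y => (φ k).normed volume (x - y)) :=
      ⟨(hρ k).comp (contDiff_const.sub contDiff_id),
        hasCompactSupport_comp_sub_left (hρc k) x, hsub.trans hRΩ⟩
    have h4 := h _ htest
    rw [pairingD_eq_of_eqOn htest hf1 fun y hy =>
      Set.indicator_of_mem (Metric.ball_subset_closedBall (hsub hy)) u, LinearMap.id_apply] at h4
    rw [fderiv_convolution_eq ((hρ k).of_le (by simp)) (hρc k) hf1, h4]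
    rfl
  choose c hc using hconst
  have hpos : volume (Metric.ball x₀ r) ≠ 0 := (Metric.measure_ball_pos volume x₀ hr).ne'
  have hae : ∀ᵐ x ∂volume.restrict (Metric.ball x₀ r), Tendsto c atTop (𝓝 (u x)) := by
    filter_upwards [ae_restrict_of_ae hconv, ae_restrict_mem Metric.isOpen_ball.measurableSet]
      with x hx hxb
    have hfx : f x = u x := Set.indicator_of_mem
      (Metric.ball_subset_closedBall (Metric.ball_subset_ball (half_le_self hR.le) hxb)) u
    rw [← hfx]
    exact hx.congr fun k => hc k x hxb
  have hne : NeBot (ae (volume.restrict (Metric.ball x₀ r))) := by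
    rw [ae_neBot]
    exact fun h0 => hpos (Measure.restrict_eq_zero.1 h0)
  obtain ⟨x₁, hx₁⟩ := hae.exists
  exact ⟨u x₁, hae.mono fun x hx => tendsto_nhds_unique hx hx₁⟩

theorem exists_ae_eq_const_of_dEqZero (hp : 1 ≤ p) {Ω : Set (E n)} (hΩ : IsOpen Ω)
    (hΩc : IsPreconnected Ω) {u : E n → E m} (hu : MemLpLoc p u)
    (h : DEqZero LinearMap.id Ω u) : ∃ c : E m, ∀ᵐ x ∂volume.restrict Ω, u x = c := by
  rcases Ω.eq_empty_or_nonempty with rfl | ⟨x₀, hx₀⟩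
  · exact ⟨0, by simp⟩
  -- The local a.e. value of `u` at `x`. It is unique because balls have positive measure, and
  -- locally constant in `x`, so connectedness propagates it through `Ω`.
  let P : E n → E m → Prop := fun x c =>
    ∃ r > 0, ∀ᵐ y ∂volume.restrict (Metric.ball x r), u y = c
  have hP : ∀ x ∈ Ω, ∃ c, P x c := fun x hx => by
    obtain ⟨r, hr, c, hc⟩ := exists_ae_eq_const_ball hp hΩ hu h hx
    exact ⟨c, r, hr, hc⟩
  have huniq : ∀ x c c', P x c → P x c' → c = c' := by
    rintro x c c' ⟨r, hr, hc⟩ ⟨r', hr', hc'⟩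
    have hpos : volume (Metric.ball x (min r r')) ≠ 0 :=
      (Metric.measure_ball_pos volume x (lt_min hr hr')).ne'
    have hne : NeBot (ae (volume.restrict (Metric.ball x (min r r')))) := by
      rw [ae_neBot]
      exact fun h0 => hpos (Measure.restrict_eq_zero.1 h0)
    obtain ⟨y, h1, h2⟩ := ((ae_restrict_of_ae_restrict_of_subset
      (Metric.ball_subset_ball (min_le_left r r')) hc).and (ae_restrict_of_ae_restrict_of_subset
      (Metric.ball_subset_ball (min_le_right r r')) hc')).exists
    exact h1.symm.trans h2
  have hopen : ∀ x c, P x c → ∀ᶠ y in 𝓝 x, P y c := by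
    rintro x c ⟨r, hr, hc⟩
    filter_upwards [Metric.ball_mem_nhds x hr] with y hy
    obtain ⟨r', hr', hsub⟩ := Metric.isOpen_iff.1 Metric.isOpen_ball y hy
    exact ⟨r', hr', ae_restrict_of_ae_restrict_of_subset hsub hc⟩
  obtain ⟨c, hc⟩ := hP x₀ hx₀
  have hall : ∀ x ∈ Ω, P x c := by
    intro x hx
    have := hΩc.induction₂ (fun x y => ∀ c, P x c ↔ P y c) ?_
      (fun x y z _ _ _ h1 h2 c => (h1 c).trans (h2 c)) (fun x y _ _ h1 c => (h1 c).symm) hx₀ hx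
    · exact (this c).1 hc
    · intro x hx
      obtain ⟨d, hd⟩ := hP x hx
      filter_upwards [mem_nhdsWithin_of_mem_nhds (hopen x d hd)] with y hy c
      exact ⟨fun h => huniq x c d h hd ▸ hy, fun h => huniq y c d h hy ▸ hd⟩
  refine ⟨c, ?_⟩
  rw [ae_restrict_iff' hΩ.measurableSet, ae_iff]
  -- Passes from null exceptional sets in uncountably many balls to a single null set.
  refine measure_null_of_locally_null _ fun x hx => ?_
  have hxΩ : x ∈ Ω := by
    by_contra hcon
    exact hx fun h => absurd h hcon
  obtain ⟨r, hr, hrc⟩ := hall x hxΩ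
  rw [ae_restrict_iff' Metric.isOpen_ball.measurableSet, ae_iff] at hrc
  refine ⟨_, inter_mem_nhdsWithin _ (Metric.ball_mem_nhds x hr), measure_mono_null ?_ hrc⟩
  rintro y ⟨hy1, hy2⟩ hcon
  exact hy1 fun _ => hcon hy2

/-! ### Strong core functionals -/

/-- A dilation multiplies gradients by the scalar `s`, which passes through `L`. A rotation would
multiply them on the right by a matrix, with which a general `L` does not commute. -/
lemma DEqZero.comp_dil {L : Mat m n →ₗ[ℝ] Mat m n} {Ω : Set (E n)} {u : E n → E m}
    (h : DEqZero L Ω u) {s : ℝ} (hs : 0 < s) (k : E n) (hD : dil n hs k '' D ⊆ Ω) :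
    DEqZero L D (u ∘ dil n hs k) := by
  intro φ hφ
  let e : E n ≃ₜ E n := Homeomorph.mk (dil n hs k).toEquiv (continuous_affineEquiv _)
    (continuous_affineEquiv (dil n hs k).symm)
  have he : ∀ y, e.symm y = s⁻¹ • (y - k) := by
    intro y
    rw [Homeomorph.symm_apply_eq]
    change y = dil n hs k _
    rw [dil_apply, smul_inv_smul₀ hs.ne', sub_add_cancel]
  have hes : ContDiff ℝ ∞ e.symm := by
    have : ⇑e.symm = fun y => s⁻¹ • (y - k) := funext he
    rw [this]
    exact (contDiff_id.sub contDiff_const).const_smul _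
  have hψ : IsTestFunction Ω (φ ∘ e.symm) := by
    refine ⟨hφ.contDiff.comp hes, hφ.hasCompactSupport.comp_homeomorph e.symm, ?_⟩
    rw [tsupport_comp_eq_preimage]
    intro y hy
    exact hD ⟨e.symm y, hφ.tsupport_subset hy, e.apply_symm_apply y⟩
  have hd : ∀ x, fderiv ℝ φ x = s • fderiv ℝ (φ ∘ e.symm) (dil n hs k x) := by
    intro x
    have h1 : φ = (φ ∘ e.symm) ∘ dil n hs k := by
      funext x
      exact congrArg φ (e.symm_apply_apply x).symm
    have h2 : HasFDerivAt (dil n hs k) (s • ContinuousLinearMap.id ℝ (E n)) x := by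
      have h4 : ⇑(dil n hs k) = fun x => s • x + k := funext fun x => dil_apply hs k x
      rw [h4]
      exact ((hasFDerivAt_id x).const_smul s).add_const k
    have h3 := (((hψ.contDiff.differentiable (by simp))
      (dil n hs k x)).hasFDerivAt.comp x h2).fderiv
    rw [← h1] at h3
    rw [h3]
    ext
    simp
  have h0 := h _ hψ
  rw [pairingD_eq hψ, neg_eq_zero] at h0
  rw [pairingD_eq hφ, neg_eq_zero]
  set H : E n → Mat m n := fun y => L ((fderiv ℝ (φ ∘ e.symm) y).smulRight (u y)) with hH
  have h5 : ∀ x, L ((fderiv ℝ φ x).smulRight ((u ∘ dil n hs k) x)) = s • H (s • x + k) := by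
    intro x
    rw [hd, hH, ← dil_apply hs k x, ← map_smul]
    congr 1
    ext
    simp [mul_assoc]
  simp_rw [h5]
  rw [integral_smul, Measure.integral_comp_smul volume (fun x => H (x + k)) s,
    integral_add_right_eq_self, h0, smul_zero, smul_zero]

lemma DEqZero.isSobolev {L : Mat m n →ₗ[ℝ] Mat m n} {v : E n → E m} (h : DEqZero L D v)
    (hDb : Bornology.IsBounded D) (hv : MemLp v (ENNReal.ofReal p) (volume.restrict D)) :
    IsSobolev L p D v fun _ => (0 : Mat m n) where
  memLp := hv
  memLp_grad := memLp_of_continuous_of_isBounded continuous_const hDb _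
  represents φ hφ := by
    rw [h φ hφ]
    refine integral_eq_zero_of_ae (Eventually.of_forall fun x => ?_)
    ext
    simp

theorem alpha_eq_zero_of_isStrong (hp : 1 ≤ p) {Ω : Set (E n)}
    (hDb : Bornology.IsBounded D) (hα : IsCore p D (gamma 𝒢) α) (h𝒢 : 𝒢 = ⊥)
    (hstrong : IsStrong hα hp) {u : E n → E m} (hu : MemLpLoc p u)
    (h : ∀ (P : Submodule ℝ (Mat m n)) (hP : IsCompl P (nullSpace hα hp)),
      DEqZero (P.projection (nullSpace hα hp) hP) Ω u) {S : Set (E n)}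
    (hS : S ∈ cells (gamma 𝒢 : Set (E n ≃ᵃ[ℝ] E n)) D Ω) : α u S = 0 := by
  obtain ⟨F, ⟨s, hs, R, hR, k, hF⟩, rfl, hFΩ⟩ := hS
  rw [h𝒢, Subgroup.mem_bot] at hR
  -- Triviality of the group enters only here: without rotations the cell map is a dilation followed
  -- by a translation.
  have hFd : F = dil n hs k := by
    ext1 x
    rw [hF, dil_apply, hR]
    simp
  subst hFd
  obtain ⟨P, hP, c, -, hc⟩ := hstrong
  rw [← hα.change_var D self_mem_cells u hu _ (dil_mem hs k)]
  have hv : MemLpLoc p (u ∘ dil n hs k) := hu.comp_dil hs k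
  have hzero := (h P hP).comp_dil hs k hFΩ
  -- The pulled-back function is Sobolev with gradient representative zero, so the strong bound
  -- reads `α ≤ 0`.
  have h1 := hc _ _ hv (hzero.isSobolev hDb ((hv _ hDb.isCompact_closure).mono_measure
    (Measure.restrict_mono subset_closure le_rfl)))
  have h0 : ‖(0 : Mat m n)‖ₑ = 0 := by
    rw [← ofReal_norm, ContinuousLinearMap.opNorm_zero, ENNReal.ofReal_zero]
  have h2 : ∫⁻ _ in D, ‖(0 : Mat m n)‖ₑ ^ p = 0 := by
    rw [h0, ENNReal.zero_rpow_of_pos (by linarith), lintegral_zero]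
  rw [h2, mul_zero, nonpos_iff_eq_zero, ENNReal.coe_eq_zero] at h1
  exact h1

end CoreBMO

theorem mainTheorem7 {n m : ℕ} {p : ℝ} (hp : 1 < p)
    (Ω : Set (CoreBMO.E n)) (hΩ : IsOpen Ω) (hΩc : IsPreconnected Ω)
    (D : Set (CoreBMO.E n)) (hD : IsOpen D) (hDb : Bornology.IsBounded D)
    (𝒢 : Subgroup (Matrix.specialOrthogonalGroup (Fin n) ℝ))
    (α : (CoreBMO.E n → CoreBMO.E m) → Set (CoreBMO.E n) → ℝ≥0)
    (hα : CoreBMO.IsCore p D (CoreBMO.gamma 𝒢) α)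
    (hlsc : CoreBMO.IsLpLsc hp.le D (CoreBMO.gamma 𝒢) α)
    (u : CoreBMO.E n → CoreBMO.E m) (hu : CoreBMO.MemLpLoc p u)
    (hG : CoreBMO.Gminus p D 𝒢 α u Ω = 0) :
    (∀ (P : Submodule ℝ (CoreBMO.Mat m n)) (hP : IsCompl P (CoreBMO.nullSpace hα hp.le)),
      CoreBMO.DEqZero (P.projection (CoreBMO.nullSpace hα hp.le) hP) Ω u) ∧
    ((∀ A : CoreBMO.Mat m n, A ≠ 0 → 0 < CoreBMO.psi p D 𝒢 α A) →
      CoreBMO.DEqZero LinearMap.id Ω u ∧ ∃ c : CoreBMO.E m, ∀ᵐ x ∂volume.restrict Ω, u x = c) ∧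
    (𝒢 = ⊥ → CoreBMO.IsStrong hα hp.le →
      ∀ D' ∈ CoreBMO.cells (CoreBMO.gamma 𝒢 : Set (CoreBMO.E n ≃ᵃ[ℝ] CoreBMO.E n)) D Ω,
        α u D' = 0) := by
  have ha : ∀ (P : Submodule ℝ (CoreBMO.Mat m n)) (hP : IsCompl P (CoreBMO.nullSpace hα hp.le)),
      CoreBMO.DEqZero (P.projection (CoreBMO.nullSpace hα hp.le) hP) Ω u := fun P hP =>
    CoreBMO.dEqZero_of_forall_psi_eq_zero hp.le hΩ hD hDb hα hlsc hu hG fun A hA =>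
      (Submodule.projection_apply_eq_zero_iff hP).2 hA
  refine ⟨ha, fun hψ => ?_, fun h𝒢 hstrong D' hD' =>
    CoreBMO.alpha_eq_zero_of_isStrong hp.le hDb hα h𝒢 hstrong hu ha hD'⟩
  -- Positivity of `psi` off zero makes the null space trivial, so the identity already kills it.
  have hb : CoreBMO.DEqZero LinearMap.id Ω u :=
    CoreBMO.dEqZero_of_forall_psi_eq_zero hp.le hΩ hD hDb hα hlsc hu hG fun A hA => by
      by_contra hne
      exact (hψ A hne).ne' hA
  exact ⟨hb, CoreBMO.exists_ae_eq_const_of_dEqZero hp.le hΩ hΩc hu hb⟩
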